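/- Let $Q\subset\mathbb R^3$ be a Platonic solid, that is, a regular tetrahedron, cube, regular octahedron, regular dodecahedron or regular icosahedron, of any size and in any position. A *convex unfolding* of $Q$ is obtained by cutting its surface $\partial Q$ along a geometric tree $\mathcal T\subset\partial Q$ (a finite tree drawn on $\partial Q$ without self-crossings, whose arcs are polygonal paths, not necessarily along edges of $Q$) and flattening the cut surface $\partial Q\setminus\mathcal T$ isometrically (with respect to the intrinsic path metric) and without overlap onto the interior of a convex polygon in the plane. Then $Q$ has a convex unfolding if and only if $Q$ is a regular tetrahedron. In other words, the regular tetrahedron has a convex unfolding, and the cube, the regular octahedron, the regular dodecahedron and the regular icosahedron have none. -/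

import Mathlib

/-- Euclidean three-space, in which polytopes live. -/
abbrev Space3 : Type := EuclideanSpace ℝ (Fin 3)

/-- The Euclidean plane, in which polygons live. -/
abbrev Plane2 : Type := EuclideanSpace ℝ (Fin 2)

/-- A geometric tree in space, all of whose arcs are polygonal paths: the nodes of a finite
combinatorial tree `G` (which include the bends of the polygonal paths) are placed at pairwise
distinct points, the edges are drawn as straight segments, and two different segments meet at most
in a common end node. `T` is the union of all nodes and segments. -/
def IsGeometricTree (T : Set Space3) : Prop :=
  ∃ (n : ℕ) (G : SimpleGraph (Fin n)) (p : Fin n → Space3),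
    G.IsTree ∧ Function.Injective p ∧
    (∀ i j k l : Fin n, G.Adj i j → G.Adj k l → s(i, j) ≠ s(k, l) →
      segment ℝ (p i) (p j) ∩ segment ℝ (p k) (p l) ⊆ {p i, p j} ∩ {p k, p l}) ∧
    T = Set.range p ∪ ⋃ (i : Fin n) (j : Fin n) (_ : G.Adj i j), segment ℝ (p i) (p j)

/-- Cutting the surface `frontier Q` of the (solid, three-dimensional) polytope `Q` along `T` and
flattening it into the plane produces the region `P` without overlap: there is a homeomorphism
from the cut surface onto the interior of `P` that preserves the length of every straight segment
lying on the cut surface.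

A segment lies on the surface exactly when it lies in one closed face. So the condition says that
`φ` moves the pieces of each face rigidly; since `φ` is a homeomorphism, pieces that meet along an
uncut part of an edge are laid out on opposite sides of the image of that part. Thus `φ` is
an isometry for the intrinsic (path-length) metrics of the cut surface and of the interior
of `P`. -/
def FlattensOnto (Q T : Set Space3) (P : Set Plane2) : Prop :=
  ∃ φ : ↥(frontier Q \ T) ≃ₜ ↥(interior P),
    ∀ y z : ↥(frontier Q \ T),
      segment ℝ (y : Space3) (z : Space3) ⊆ frontier Q \ T → dist (φ y) (φ z) = dist y z

/-- `P` is an unfolding of the polytope `Q`: some geometric tree drawn on the surface of `Q` is a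
cut tree that leads to `P`. -/
def IsUnfolding (Q : Set Space3) (P : Set Plane2) : Prop :=
  ∃ T : Set Space3, IsGeometricTree T ∧ T ⊆ frontier Q ∧ FlattensOnto Q T P

/-- A (nondegenerate, closed) convex polygon in the plane. -/
def IsConvexPolygon (P : Set Plane2) : Prop :=
  (∃ V : Set Plane2, V.Finite ∧ P = convexHull ℝ V) ∧ (interior P).Nonempty

/-- `Q` has a convex unfolding: an unfolding that produces a convex polygon. -/
def HasConvexUnfolding (Q : Set Space3) : Prop :=
  ∃ P : Set Plane2, IsConvexPolygon P ∧ IsUnfolding Q P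

/-- The names of the five Platonic solids. -/
inductive PlatonicSolid : Type
  | tetrahedron
  | cube
  | octahedron
  | dodecahedron
  | icosahedron

/-- Cartesian coordinates of the vertices of the five Platonic solids, centred at the origin.
The index arithmetic on `Fin 3` is cyclic, so `i, i + 1, i + 2` runs through the cyclic
permutations of the coordinates. -/
noncomputable def PlatonicSolid.vertices : PlatonicSolid → Set Space3
  | .tetrahedron => {!₂[1, 1, 1], !₂[1, -1, -1], !₂[-1, 1, -1], !₂[-1, -1, 1]}
  | .cube => {v | ∀ i, |v i| = 1}
  | .octahedron => {v | ∃ i, |v i| = 1 ∧ v (i + 1) = 0 ∧ v (i + 2) = 0}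
  | .dodecahedron =>
      {v | ∀ i, |v i| = 1} ∪
      {v | ∃ i, v i = 0 ∧ |v (i + 1)| = Real.goldenRatio ∧ |v (i + 2)| = Real.goldenRatio⁻¹}
  | .icosahedron => {v | ∃ i, v i = 0 ∧ |v (i + 1)| = 1 ∧ |v (i + 2)| = Real.goldenRatio}

/-- `Q` is a Platonic solid of kind `s`, of any size and in any position: the image under a
similarity of space (a scaling followed by an isometry) of the convex hull of the standard
vertices. -/
def IsPlatonic (s : PlatonicSolid) (Q : Set Space3) : Prop :=
  ∃ (c : ℝ) (e : Space3 ≃ᵃⁱ[ℝ] Space3), 0 < c ∧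
    Q = (fun x : Space3 => e (c • x)) '' convexHull ℝ s.vertices

/-! A finite tree has a node `v` with at most one neighbour, so near `v` the cut lies on a single
ray. The nearby surface off this ray is laid out without overlap around a point `p` of the plane.
This `p` is not interior to the polygon, because its preimage would have to be `v`, which has been
cut away. By convexity the interior of the polygon then lies in an open half plane bounded by a line
through `p`. Closed sectors laid out side by side around `p` in an open half plane have total angle
less than π (`sum_angle_lt_pi`, `IsFan.not_flattensOnto`). So there is no convex unfolding if every
point of the surface has, off any given ray, consecutive flat sectors of total angle at least π: a
fan.

At a point that is not a vertex the full angle is 2π, and two suitable triangles of total angle π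
avoid the ray (`exists_isFan_of_notMem`). At a vertex with `k` congruent faces, avoiding the ray
costs at most one face, or two half faces if the ray runs along an edge
(`IsPolyhedralCorner.exists_isFan`). The remaining `k - 1` face angles amount to 2·90° for the cube,
3·60° for the octahedron, 4·60° for the icosahedron and 2·108° for the dodecahedron, always at least
π. For the tetrahedron they amount to only 2·60°.

Conversely, cutting the regular tetrahedron along the three edges at one vertex and turning the
three flaps into the plane of the base gives an equilateral triangle of twice the edge length
(`Tetrahedron.flattensOnto_triangle`). An explicit formula for this map and its inverse proves it.
-/

open Filter Topology

/-! ### Triangles with a corner at the origin. -/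

/-- The triangle spanned by two vectors and the origin. -/
def wedge {E : Type*} [AddCommGroup E] [Module ℝ E] (x y : E) : Set E :=
  {z | ∃ a b : ℝ, 0 ≤ a ∧ 0 ≤ b ∧ a + b ≤ 1 ∧ z = a • x + b • y}

section Wedge

variable {E : Type*} [AddCommGroup E] [Module ℝ E] {x y z w : E}

theorem zero_mem_wedge : (0 : E) ∈ wedge x y :=
  ⟨0, 0, le_rfl, le_rfl, by norm_num, by simp⟩

theorem left_mem_wedge : x ∈ wedge x y :=
  ⟨1, 0, by norm_num, le_rfl, by norm_num, by simp⟩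

theorem right_mem_wedge : y ∈ wedge x y :=
  ⟨0, 1, le_rfl, by norm_num, by norm_num, by simp⟩

theorem wedge_comm : wedge x y = wedge y x := by
  ext z
  constructor <;> rintro ⟨a, b, ha, hb, hab, rfl⟩ <;>
    exact ⟨b, a, hb, ha, by linarith, by rw [add_comm]⟩

theorem convex_wedge : Convex ℝ (wedge x y) := by
  rintro _ ⟨a, b, ha, hb, hab, rfl⟩ _ ⟨c, d, hc, hd, hcd, rfl⟩ s t hs ht hst
  refine ⟨s * a + t * c, s * b + t * d, by positivity, by positivity, ?_, ?_⟩
  · nlinarith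
  · module

theorem smul_mem_wedge (hz : z ∈ wedge x y) {c : ℝ} (hc : 0 ≤ c) (hc1 : c ≤ 1) :
    c • z ∈ wedge x y := by
  have := convex_wedge hz (zero_mem_wedge (x := x) (y := y)) hc (sub_nonneg.2 hc1) (by ring)
  simpa using this

theorem wedge_subset_of_convex {C : Set E} (hC : Convex ℝ C) (h0 : (0 : E) ∈ C) (hx : x ∈ C)
    (hy : y ∈ C) : wedge x y ⊆ C := by
  rintro _ ⟨s, t, hs, ht, hst, rfl⟩
  have := hC.sum_mem (t := Finset.univ) (w := ![1 - s - t, s, t]) (z := ![0, x, y])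
    (by intro i _; fin_cases i <;> simp <;> linarith)
    (by simp [Fin.sum_univ_three]; ring) (by intro i _; fin_cases i <;> simp [h0, hx, hy])
  simpa [Fin.sum_univ_three] using this

/-- The cone spanned by two vectors is pointed. -/
def PointedPair (x y : E) : Prop :=
  ∀ s t : ℝ, 0 ≤ s → 0 ≤ t → s • x + t • y = 0 → s = 0 ∧ t = 0

/-- The apex of a fan is a cut point, and lengths are only known to be preserved along segments off
the cut. This lemma keeps segments inside a triangle away from its apex. -/
theorem PointedPair.zero_notMem_segment (h : PointedPair x y) (hz : z ∈ wedge x y)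
    (hw : w ∈ wedge x y) (hz0 : z ≠ 0) (hw0 : w ≠ 0) : (0 : E) ∉ segment ℝ z w := by
  obtain ⟨a, b, ha, hb, hab, rfl⟩ := hz
  obtain ⟨c, d, hc, hd, hcd, rfl⟩ := hw
  rintro ⟨s, t, hs, ht, hst, h0⟩
  obtain ⟨h1, h2⟩ := h (s * a + t * c) (s * b + t * d) (by positivity) (by positivity)
    (by rw [← h0]; module)
  have e1 : s * a = 0 ∧ t * c = 0 := by
    constructor <;> nlinarith [mul_nonneg hs ha, mul_nonneg ht hc]
  have e2 : s * b = 0 ∧ t * d = 0 := by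
    constructor <;> nlinarith [mul_nonneg hs hb, mul_nonneg ht hd]
  rcases eq_or_ne s 0 with rfl | hs0
  · have ht1 : t = 1 := by linarith
    subst ht1
    exact hw0 (by simp_all)
  · exact hz0 (by simp_all)

end Wedge

/-! ### Developing a fan of triangles into a half plane. -/

section Planar

variable {E : Type*} [NormedAddCommGroup E] [InnerProductSpace ℝ E]

/-- Polarization: distances to the origin and mutual distances determine inner products. No
linearity of `u` is needed. -/
theorem inner_eq_of_dist_eq {F : Type*} [NormedAddCommGroup F] [InnerProductSpace ℝ F] {s : Set E}
    {u : E → F} (h0 : (0 : E) ∈ s) (hu0 : u 0 = 0)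
    (hu : ∀ y ∈ s, ∀ z ∈ s, dist (u y) (u z) = dist y z) {y z : E} (hy : y ∈ s) (hz : z ∈ s) :
    inner ℝ (u y) (u z) = inner ℝ y z := by
  have n (w : E) (hw : w ∈ s) : ‖u w‖ = ‖w‖ := by
    simpa [hu0] using hu w hw 0 h0
  have := hu y hy z hz
  rw [dist_eq_norm, dist_eq_norm] at this
  have e1 := norm_sub_sq_real (u y) (u z)
  have e2 := norm_sub_sq_real y z
  rw [this, n y hy, n z hz] at e1
  linarith

/-- In the right half plane arguments lie in (-π/2, π/2), so their difference does not wrap around.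
-/
theorem Complex.angle_eq_abs_arg_sub {a b : ℂ} (ha : 0 < a.re) (hb : 0 < b.re) :
    InnerProductGeometry.angle a b = |a.arg - b.arg| := by
  have ha0 : a ≠ 0 := fun h => by simp [h] at ha
  have hb0 : b ≠ 0 := fun h => by simp [h] at hb
  have h1 := abs_lt.1 (Complex.abs_arg_lt_pi_div_two_iff.2 (Or.inl ha))
  have h2 := abs_lt.1 (Complex.abs_arg_lt_pi_div_two_iff.2 (Or.inl hb))
  have e : (a / b).arg = a.arg - b.arg := by
    have h3 := Complex.arg_div_coe_angle ha0 hb0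
    rw [← Real.Angle.coe_sub] at h3
    have h4 := congrArg Real.Angle.toReal h3
    rw [Complex.arg_coe_angle_toReal_eq_arg, Real.Angle.toReal_coe_eq_self_iff.2 ⟨by linarith, by linarith⟩] at h4
    exact h4
  rw [Complex.angle_eq_abs_arg ha0 hb0, e]

/-- A wedge that is mapped isometrically into an open half plane: the arguments attained on the
wedge fill the interval between those of the two sides. -/
theorem exists_mem_wedge_arg_eq {x y : E} {u : E → ℂ} (hxy : PointedPair x y)
    (hu : ∀ a ∈ wedge x y, ∀ b ∈ wedge x y, dist (u a) (u b) = dist a b)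
    (hpos : ∀ a ∈ wedge x y, a ≠ 0 → 0 < (u a).re) {c : ℝ} (h1 : (u x).arg ≤ c)
    (h2 : c ≤ (u y).arg) :
    ∃ z ∈ wedge x y, z ≠ 0 ∧ (u z).arg = c := by
  set γ : ℝ → E := fun t => (1 - t) • x + t • y
  have hγ : ∀ t ∈ Set.Icc (0 : ℝ) 1, γ t ∈ wedge x y ∧ γ t ≠ 0 := by
    rintro t ⟨ht0, ht1⟩
    refine ⟨⟨1 - t, t, by linarith, ht0, by linarith, rfl⟩, fun h => ?_⟩
    have := hxy (1 - t) t (by linarith) ht0 h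
    linarith
  have hc : ContinuousOn (fun t => (u (γ t)).arg) (Set.Icc 0 1) := by
    have hcu : ContinuousOn u (wedge x y) := by
      refine LipschitzOnWith.continuousOn (K := 1) (LipschitzOnWith.of_dist_le_mul ?_)
      intro a ha b hb
      simp [hu a ha b hb]
    have hcγ : Continuous γ := by fun_prop
    intro t ht
    refine (Complex.continuousAt_arg (Or.inl (hpos _ (hγ t ht).1 (hγ t ht).2))).comp_continuousWithinAt
      (f := fun t => u (γ t)) ?_
    exact (hcu.comp hcγ.continuousOn fun t ht => (hγ t ht).1) t ht
  have hivt := intermediate_value_Icc (zero_le_one' ℝ) hc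
  have hcm : c ∈ Set.Icc ((u (γ 0)).arg) ((u (γ 1)).arg) := by simpa [γ] using ⟨h1, h2⟩
  obtain ⟨t, ht, hct⟩ := hivt hcm
  exact ⟨γ t, (hγ t ht).1, (hγ t ht).2, hct⟩

/-- By preservation of inner products, the squared norm of `u (c • a) - c • u a` expands to zero. -/
theorem wedge_smul_eq {x y : E} {u : E → ℂ} (hu0 : u 0 = 0)
    (hu : ∀ a ∈ wedge x y, ∀ b ∈ wedge x y, dist (u a) (u b) = dist a b) {a : E}
    (ha : a ∈ wedge x y) {c : ℝ} (hc : 0 ≤ c) (hc1 : c ≤ 1) : u (c • a) = c • u a := by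
  have hca := smul_mem_wedge ha hc hc1
  have h1 := inner_eq_of_dist_eq zero_mem_wedge hu0 hu ha ha
  have h2 := inner_eq_of_dist_eq zero_mem_wedge hu0 hu hca ha
  have h3 := inner_eq_of_dist_eq zero_mem_wedge hu0 hu hca hca
  simp only [real_inner_smul_left, real_inner_smul_right] at h2 h3
  rw [← sub_eq_zero, ← inner_self_eq_zero (𝕜 := ℝ)]
  rw [inner_sub_left, inner_sub_right, inner_sub_right, real_inner_smul_right,
    real_inner_smul_left, real_inner_smul_left, real_inner_smul_right,
    h1, h2, h3, real_inner_comm (u (c • a)) (u a), h2]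
  ring

/-- Two adjacent wedges meeting only in their common side which are developed isometrically and
injectively into an open half plane lie on different sides of the image of the common side. -/
theorem not_fold_pos {x y z : E} {u : E → ℂ} (hu0 : u 0 = 0) (hxy : PointedPair x y)
    (hyz : PointedPair y z)
    (h1 : ∀ a ∈ wedge x y, ∀ b ∈ wedge x y, dist (u a) (u b) = dist a b)
    (h2 : ∀ a ∈ wedge y z, ∀ b ∈ wedge y z, dist (u a) (u b) = dist a b)
    (p1 : ∀ a ∈ wedge x y, a ≠ 0 → 0 < (u a).re) (p2 : ∀ a ∈ wedge y z, a ≠ 0 → 0 < (u a).re)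
    (hinj : ∀ a ∈ wedge x y, ∀ b ∈ wedge y z, u a = u b → a = b)
    (hadj : ∀ a b c d : ℝ, 0 ≤ a → 0 ≤ b → 0 ≤ c → 0 ≤ d →
      a • x + b • y = c • y + d • z → a = 0 ∧ d = 0)
    (hx : (u y).arg < (u x).arg) (hz : (u y).arg < (u z).arg) : False := by
  -- If both triangles were laid out on the side of larger arguments, both would attain the argument
  -- `c`, strictly beyond the common side.
  set c := min (u x).arg (u z).arg
  have hc : (u y).arg < c := lt_min hx hz
  obtain ⟨p, hp, hp0, hpc⟩ := exists_mem_wedge_arg_eq (x := y) (y := x)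
    (fun s t hs ht h => (hxy t s ht hs (by rw [add_comm]; exact h)).symm)
    (by rwa [wedge_comm]) (by rwa [wedge_comm]) hc.le (min_le_left _ _)
  rw [wedge_comm] at hp
  obtain ⟨q, hq, hq0, hqc⟩ := exists_mem_wedge_arg_eq hyz h2 p2 hc.le (min_le_right _ _)
  have hup : 0 < ‖u p‖ := norm_pos_iff.2 fun h => by simpa [h] using p1 p hp hp0
  have huq : 0 < ‖u q‖ := norm_pos_iff.2 fun h => by simpa [h] using p2 q hq hq0
  -- rescaled points of the two wedges with the same image
  have key : ∃ s t : ℝ, 0 < s ∧ s ≤ 1 ∧ 0 < t ∧ t ≤ 1 ∧ s • u p = t • u q := by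
    -- Scaling both images to the same length with factors at most one keeps the points inside their
    -- triangles.
    set r := max ‖u p‖ ‖u q‖
    have hr : 0 < r := lt_max_of_lt_left hup
    refine ⟨‖u q‖ / r, ‖u p‖ / r, by positivity, (div_le_one hr).2 (le_max_right _ _),
      by positivity, (div_le_one hr).2 (le_max_left _ _), ?_⟩
    have e1 := Complex.norm_mul_exp_arg_mul_I (u p)
    have e2 := Complex.norm_mul_exp_arg_mul_I (u q)
    rw [hpc] at e1
    rw [hqc] at e2
    rw [← e1, ← e2]
    simp only [Complex.real_smul, norm_mul, Complex.norm_exp_ofReal_mul_I, Complex.norm_real,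
      norm_norm, mul_one]
    push_cast
    ring
  obtain ⟨s, t, hs, hs1, ht, ht1, hst⟩ := key
  rw [← wedge_smul_eq hu0 h1 hp hs.le hs1, ← wedge_smul_eq hu0 h2 hq ht.le ht1] at hst
  -- Injectivity puts the common point on the common side, whose image has argument `(u y).arg`, not
  -- `c`.
  have hpq := hinj _ (smul_mem_wedge hp hs.le hs1) _ (smul_mem_wedge hq ht.le ht1) hst
  obtain ⟨a, b, ha, hb, hab, rfl⟩ := hp
  obtain ⟨a', b', ha', hb', hab', rfl⟩ := hq
  obtain ⟨h3, -⟩ := hadj (s * a) (s * b) (t * a') (t * b') (by positivity) (by positivity)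
    (by positivity) (by positivity) (by simpa [smul_smul, smul_add] using hpq)
  have ha0 : a = 0 := by
    rcases mul_eq_zero.1 h3 with h | h
    · exact absurd h hs.ne'
    · exact h
  subst ha0
  have hb0 : b ≠ 0 := fun h => hp0 (by simp [h])
  have : u ((0 : ℝ) • x + b • y) = b • u y := by
    rw [zero_smul, zero_add]
    exact wedge_smul_eq hu0 h1 right_mem_wedge hb (by linarith)
  rw [this, Complex.real_smul, Complex.arg_real_mul _ (lt_of_le_of_ne hb hb0.symm)] at hpc
  exact hc.ne hpc

/-- Complex conjugation preserves the right half plane and reverses arguments, which reduces this to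
`not_fold_pos`. -/
theorem not_fold_neg {x y z : E} {u : E → ℂ} (hu0 : u 0 = 0) (hxy : PointedPair x y)
    (hyz : PointedPair y z)
    (h1 : ∀ a ∈ wedge x y, ∀ b ∈ wedge x y, dist (u a) (u b) = dist a b)
    (h2 : ∀ a ∈ wedge y z, ∀ b ∈ wedge y z, dist (u a) (u b) = dist a b)
    (p1 : ∀ a ∈ wedge x y, a ≠ 0 → 0 < (u a).re) (p2 : ∀ a ∈ wedge y z, a ≠ 0 → 0 < (u a).re)
    (hinj : ∀ a ∈ wedge x y, ∀ b ∈ wedge y z, u a = u b → a = b)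
    (hadj : ∀ a b c d : ℝ, 0 ≤ a → 0 ≤ b → 0 ≤ c → 0 ≤ d →
      a • x + b • y = c • y + d • z → a = 0 ∧ d = 0)
    (hx : (u x).arg < (u y).arg) (hz : (u z).arg < (u y).arg) : False := by
  have harg (w : ℂ) (hw : 0 < w.re) : ((starRingEnd ℂ) w).arg = -w.arg := by
    rw [Complex.arg_conj, if_neg]
    have := abs_lt.1 (Complex.abs_arg_lt_pi_div_two_iff.2 (Or.inl hw))
    linarith [Real.pi_pos]
  have nx : x ≠ 0 := fun h => by simpa using (hxy 1 0 zero_le_one le_rfl (by simp [h])).1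
  have ny : y ≠ 0 := fun h => by simpa using (hxy 0 1 le_rfl zero_le_one (by simp [h])).2
  have nz : z ≠ 0 := fun h => by simpa using (hyz 0 1 le_rfl zero_le_one (by simp [h])).2
  have px := p1 x left_mem_wedge nx
  have py := p1 y right_mem_wedge ny
  have pz := p2 z right_mem_wedge nz
  refine not_fold_pos (u := fun a => (starRingEnd ℂ) (u a)) (by simp [hu0]) hxy hyz
    (fun a ha b hb => by rw [Complex.dist_conj_conj, h1 a ha b hb])
    (fun a ha b hb => by rw [Complex.dist_conj_conj, h2 a ha b hb])
    (by simpa using p1) (by simpa using p2)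
    (fun a ha b hb h => hinj a ha b hb (star_injective h)) hadj ?_ ?_
  · rw [harg _ px, harg _ py]; linarith
  · rw [harg _ pz, harg _ py]; linarith

/-- A fan of wedges that is developed isometrically and injectively into an open half plane has
total angle less than `π`. -/
theorem sum_angle_lt_pi {m : ℕ} {x : ℕ → E} {u : E → ℂ} (hu0 : u 0 = 0)
    (hp : ∀ i < m, PointedPair (x i) (x (i + 1)))
    (hu : ∀ i < m, ∀ a ∈ wedge (x i) (x (i + 1)), ∀ b ∈ wedge (x i) (x (i + 1)),
      dist (u a) (u b) = dist a b)
    (hpos : ∀ i < m, ∀ a ∈ wedge (x i) (x (i + 1)), a ≠ 0 → 0 < (u a).re)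
    (hinj : ∀ i, i + 1 < m → ∀ a ∈ wedge (x i) (x (i + 1)), ∀ b ∈ wedge (x (i + 1)) (x (i + 2)),
      u a = u b → a = b)
    (hadj : ∀ i, i + 1 < m → ∀ a b c d : ℝ, 0 ≤ a → 0 ≤ b → 0 ≤ c → 0 ≤ d →
      a • x i + b • x (i + 1) = c • x (i + 1) + d • x (i + 2) → a = 0 ∧ d = 0) :
    ∑ i ∈ Finset.range m, InnerProductGeometry.angle (x i) (x (i + 1)) < Real.pi := by
  rcases Nat.eq_zero_or_pos m with rfl | hm
  · simpa using Real.pi_pos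
  set θ : ℕ → ℝ := fun i => (u (x i)).arg
  have nx : ∀ i < m, x i ≠ 0 ∧ x (i + 1) ≠ 0 := fun i hi =>
    ⟨fun h => by simpa using (hp i hi 1 0 zero_le_one le_rfl (by simp [h])).1,
     fun h => by simpa using (hp i hi 0 1 le_rfl zero_le_one (by simp [h])).2⟩
  have hre : ∀ i < m, 0 < (u (x i)).re ∧ 0 < (u (x (i + 1))).re := fun i hi =>
    ⟨hpos i hi _ left_mem_wedge (nx i hi).1, hpos i hi _ right_mem_wedge (nx i hi).2⟩
  have hang : ∀ i < m, InnerProductGeometry.angle (x i) (x (i + 1)) = |θ i - θ (i + 1)| := by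
    intro i hi
    rw [← Complex.angle_eq_abs_arg_sub (hre i hi).1 (hre i hi).2]
    have hin := fun a b => inner_eq_of_dist_eq (y := a) (z := b) zero_mem_wedge hu0 (hu i hi)
    have n1 : ‖u (x i)‖ = ‖x i‖ := by
      simpa [hu0] using hu i hi _ left_mem_wedge 0 zero_mem_wedge
    have n2 : ‖u (x (i + 1))‖ = ‖x (i + 1)‖ := by
      simpa [hu0] using hu i hi _ right_mem_wedge 0 zero_mem_wedge
    rw [InnerProductGeometry.angle, InnerProductGeometry.angle, n1, n2,
      hin _ _ left_mem_wedge right_mem_wedge]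
  have hlast : |θ 0 - θ m| < Real.pi := by
    have a1 := abs_lt.1 (Complex.abs_arg_lt_pi_div_two_iff.2 (Or.inl (hre 0 hm).1))
    have a2 := abs_lt.1 (Complex.abs_arg_lt_pi_div_two_iff.2 (Or.inl (hre (m - 1) (by omega)).2))
    rw [Nat.sub_add_cancel hm] at a2
    rw [abs_lt]
    constructor <;> simp only [θ] <;> linarith
  -- The sequence of arguments has no strict local extremum; together with `hne` it is monotone, so
  -- the sum of angles telescopes to `|θ 0 - θ m|`.
  have step : ∀ i, i + 1 < m →
      ¬ (θ (i + 1) < θ i ∧ θ (i + 1) < θ (i + 2)) ∧ ¬ (θ i < θ (i + 1) ∧ θ (i + 2) < θ (i + 1)) := by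
    intro i hi
    refine ⟨fun h => ?_, fun h => ?_⟩
    · exact not_fold_pos hu0 (hp i (by omega)) (hp (i + 1) hi) (hu i (by omega)) (hu (i + 1) hi)
        (hpos i (by omega)) (hpos (i + 1) hi) (hinj i hi) (hadj i hi) h.1 h.2
    · exact not_fold_neg hu0 (hp i (by omega)) (hp (i + 1) hi) (hu i (by omega)) (hu (i + 1) hi)
        (hpos i (by omega)) (hpos (i + 1) hi) (hinj i hi) (hadj i hi) h.1 h.2
  have hzero : ∀ i < m, θ i = θ (i + 1) → ∃ r : ℝ, 0 < r ∧ x (i + 1) = r • x i := by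
    intro i hi h
    have := hang i hi
    rw [h, sub_self, abs_zero, InnerProductGeometry.angle_eq_zero_iff] at this
    exact this.2
  -- Equal consecutive arguments would mean a zero angle, hence parallel sides, and the neighbouring
  -- triangle would overlap beyond the common side.
  have hne : ∀ i, i + 1 < m → θ i ≠ θ (i + 1) ∧ θ (i + 1) ≠ θ (i + 2) := by
    refine fun i hi => ⟨fun h => ?_, fun h => ?_⟩
    · obtain ⟨r, hr, h⟩ := hzero i (by omega) h
      have := (hadj i hi r 0 1 0 hr.le le_rfl zero_le_one le_rfl (by simp [h])).1
      exact hr.ne' this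
    · obtain ⟨r, hr, h⟩ := hzero (i + 1) hi h
      have := (hadj i hi 0 r 0 1 le_rfl hr.le le_rfl zero_le_one
        (by rw [show i + 2 = i + 1 + 1 from rfl, h]; simp)).2
      exact one_ne_zero this
  rw [Finset.sum_congr rfl fun i hi => hang i (Finset.mem_range.1 hi)]
  rcases le_total (θ 0) (θ 1) with h01 | h01
  · have hmono : ∀ i < m, θ i ≤ θ (i + 1) := by
      intro i
      induction i with
      | zero => exact fun _ => h01
      | succ i ih =>
        intro hi
        by_contra! hlt
        exact (step i hi).2 ⟨lt_of_le_of_ne (ih (by omega)) (hne i hi).1, hlt⟩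
    rw [Finset.sum_congr rfl fun i hi => show |θ i - θ (i + 1)| = θ (i + 1) - θ i by
      rw [abs_sub_comm, abs_of_nonneg (sub_nonneg.2 (hmono i (Finset.mem_range.1 hi)))],
      Finset.sum_range_sub]
    rw [abs_sub_comm] at hlast
    exact (le_abs_self _).trans_lt hlast
  · have hmono : ∀ i < m, θ (i + 1) ≤ θ i := by
      intro i
      induction i with
      | zero => exact fun _ => h01
      | succ i ih =>
        intro hi
        by_contra! hlt
        exact (step i hi).1 ⟨lt_of_le_of_ne (ih (by omega)) (hne i hi).1.symm, hlt⟩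
    rw [Finset.sum_congr rfl fun i hi => show |θ i - θ (i + 1)| = θ i - θ (i + 1) by
      rw [abs_of_nonneg (sub_nonneg.2 (hmono i (Finset.mem_range.1 hi)))],
      Finset.sum_range_sub']
    exact (le_abs_self _).trans_lt hlast

end Planar

/-! ### Fans on the surface and their development around the end of a cut. -/

/-- A fan at the point `v` of the surface of `Q`: consecutive triangles on the surface, two
adjacent ones meeting only in their common side, none of them meeting the ray in direction `d`, and
of total angle at least `π`. -/
structure IsFan (Q : Set Space3) (v d : Space3) (m : ℕ) (x : ℕ → Space3) : Prop where
  pointed : ∀ i < m, PointedPair (x i) (x (i + 1))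
  mem : ∀ i < m, ∀ z ∈ wedge (x i) (x (i + 1)), v + z ∈ frontier Q
  avoid : ∀ i < m, ∀ s t r : ℝ, 0 ≤ s → 0 ≤ t → 0 ≤ r → s • x i + t • x (i + 1) = r • d →
    s = 0 ∧ t = 0
  adj : ∀ i, i + 1 < m → ∀ a b c d : ℝ, 0 ≤ a → 0 ≤ b → 0 ≤ c → 0 ≤ d →
    a • x i + b • x (i + 1) = c • x (i + 1) + d • x (i + 2) → a = 0 ∧ d = 0
  angle : Real.pi ≤ ∑ i ∈ Finset.range m, InnerProductGeometry.angle (x i) (x (i + 1))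

theorem wedge_smul {E : Type*} [AddCommGroup E] [Module ℝ E] {x y z : E} {δ : ℝ}
    (hz : z ∈ wedge (δ • x) (δ • y)) : ∃ w ∈ wedge x y, z = δ • w := by
  obtain ⟨a, b, ha, hb, hab, rfl⟩ := hz
  exact ⟨a • x + b • y, ⟨a, b, ha, hb, hab, rfl⟩, by module⟩

theorem IsFan.smul {Q : Set Space3} {v d : Space3} {m : ℕ} {x : ℕ → Space3} (h : IsFan Q v d m x)
    {δ : ℝ} (hδ : 0 < δ) (hδ1 : δ ≤ 1) : IsFan Q v d m (fun i => δ • x i) where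
  pointed i hi s t hs ht h0 := by
    obtain ⟨h1, h2⟩ := h.pointed i hi (s * δ) (t * δ) (by positivity) (by positivity)
      (by simpa [smul_smul] using h0)
    exact ⟨(mul_eq_zero.1 h1).resolve_right hδ.ne', (mul_eq_zero.1 h2).resolve_right hδ.ne'⟩
  mem i hi z hz := by
    obtain ⟨w, hw, rfl⟩ := wedge_smul hz
    exact h.mem i hi _ (smul_mem_wedge hw hδ.le hδ1)
  avoid i hi s t r hs ht hr h0 := by
    obtain ⟨h1, h2⟩ := h.avoid i hi (s * δ) (t * δ) r (by positivity) (by positivity) hr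
      (by simpa [smul_smul] using h0)
    exact ⟨(mul_eq_zero.1 h1).resolve_right hδ.ne', (mul_eq_zero.1 h2).resolve_right hδ.ne'⟩
  adj i hi a b c e ha hb hc he h0 := by
    obtain ⟨h1, h2⟩ := h.adj i hi (a * δ) (b * δ) (c * δ) (e * δ) (by positivity) (by positivity)
      (by positivity) (by positivity) (by simpa [smul_smul] using h0)
    exact ⟨(mul_eq_zero.1 h1).resolve_right hδ.ne', (mul_eq_zero.1 h2).resolve_right hδ.ne'⟩
  angle := by
    simpa [InnerProductGeometry.angle_smul_left_of_pos _ _ hδ,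
      InnerProductGeometry.angle_smul_right_of_pos _ _ hδ] using h.angle

theorem norm_le_of_mem_wedge {E : Type*} [NormedAddCommGroup E] [NormedSpace ℝ E] {x y z : E}
    {r : ℝ} (hx : ‖x‖ < r) (hy : ‖y‖ < r) (hz : z ∈ wedge x y) : ‖z‖ < r := by
  obtain ⟨a, b, ha, hb, hab, rfl⟩ := hz
  have hr : 0 < r := (norm_nonneg x).trans_lt hx
  calc ‖a • x + b • y‖ ≤ a * ‖x‖ + b * ‖y‖ := by
        refine (norm_add_le _ _).trans ?_
        rw [norm_smul, norm_smul, Real.norm_of_nonneg ha, Real.norm_of_nonneg hb]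
    _ < r := by
        rcases eq_or_lt_of_le ha with rfl | ha'
        · rcases eq_or_lt_of_le hb with rfl | hb'
          · simpa using hr
          · nlinarith
        · nlinarith

/-- The shape of the cut is known only close to the apex, so the fan has to be shrunk into a
prescribed ball. -/
theorem IsFan.exists_small {Q : Set Space3} {v d : Space3} {m : ℕ} {x : ℕ → Space3}
    (h : IsFan Q v d m x) {ε : ℝ} (hε : 0 < ε) :
    ∃ y, IsFan Q v d m y ∧ ∀ i < m, ∀ z ∈ wedge (y i) (y (i + 1)), ‖z‖ < ε := by
  set M := ∑ i ∈ Finset.range (m + 1), ‖x i‖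
  have hM : 0 ≤ M := Finset.sum_nonneg fun _ _ => norm_nonneg _
  have hMi : ∀ i ≤ m, ‖x i‖ ≤ M := fun i hi =>
    Finset.single_le_sum (f := fun i => ‖x i‖) (fun _ _ => norm_nonneg _)
      (Finset.mem_range.2 (by omega))
  set δ := min 1 (ε / (M + 1))
  have hδ : 0 < δ := lt_min one_pos (by positivity)
  have hb : ∀ i ≤ m, ‖δ • x i‖ < ε := by
    intro i hi
    rw [norm_smul, Real.norm_of_nonneg hδ.le]
    calc δ * ‖x i‖ ≤ ε / (M + 1) * M :=
          mul_le_mul (min_le_right _ _) (hMi i hi) (norm_nonneg _) (by positivity)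
      _ < ε := by
          rw [div_mul_eq_mul_div, div_lt_iff₀ (by positivity)]
          nlinarith
  exact ⟨_, h.smul hδ (min_le_left _ _), fun i hi z hz =>
    norm_le_of_mem_wedge (hb i hi.le) (hb (i + 1) hi) hz⟩

/-- The development of a fan: if the nonzero vectors of the wedges of a fan at `v` are moved by `ψ`
isometrically on each wedge, then these movements share the image of `v`. -/
theorem exists_apex {E F : Type*} [NormedAddCommGroup E] [NormedSpace ℝ E] [NormedAddCommGroup F]
    [CompleteSpace F] {m : ℕ} (hm : 0 < m) {x : ℕ → E} (hx : ∀ i ≤ m, x i ≠ 0) {ψ : E → F}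
    (hψ : ∀ i < m, ∀ a ∈ wedge (x i) (x (i + 1)), ∀ b ∈ wedge (x i) (x (i + 1)), a ≠ 0 → b ≠ 0 →
      dist (ψ a) (ψ b) = dist a b) :
    ∃ p : F, (∀ i ≤ m, Tendsto (fun n : ℕ => ψ ((1 / ((n : ℝ) + 1)) • x i)) atTop (𝓝 p)) ∧
      ∀ i < m, ∀ a ∈ wedge (x i) (x (i + 1)), a ≠ 0 → dist (ψ a) p = ‖a‖ := by
  set c : ℕ → ℝ := fun n => 1 / ((n : ℝ) + 1)
  have hc0 : ∀ n, 0 < c n := fun n => by positivity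
  have hc1 : ∀ n, c n ≤ 1 := fun n => by
    simp only [c]; rw [div_le_one (by positivity)]; linarith [n.cast_nonneg (α := ℝ)]
  have hc : Tendsto c atTop (𝓝 0) := tendsto_one_div_add_atTop_nhds_zero_nat
  have hcx (y : E) : Tendsto (fun n => c n • y) atTop (𝓝 0) := by
    simpa using hc.smul_const y
  have ne (n : ℕ) {i : ℕ} (hi : i ≤ m) : c n • x i ≠ 0 := smul_ne_zero (hc0 n).ne' (hx i hi)
  have meml (n : ℕ) (i : ℕ) : c n • x i ∈ wedge (x i) (x (i + 1)) :=
    smul_mem_wedge left_mem_wedge (hc0 n).le (hc1 n)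
  have memr (n : ℕ) (i : ℕ) : c n • x (i + 1) ∈ wedge (x i) (x (i + 1)) :=
    smul_mem_wedge right_mem_wedge (hc0 n).le (hc1 n)
  have hcauchy : CauchySeq fun n => ψ (c n • x 0) := by
    have h0 := (hcx (x 0)).cauchySeq
    rw [Metric.cauchySeq_iff] at h0 ⊢
    intro ε hε
    obtain ⟨N, hN⟩ := h0 ε hε
    refine ⟨N, fun a ha b hb => ?_⟩
    rw [hψ 0 hm _ (meml a 0) _ (meml b 0) (ne a hm.le) (ne b hm.le)]
    exact hN a ha b hb
  obtain ⟨p, hp⟩ := cauchySeq_tendsto_of_complete hcauchy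
  -- The limit passes from one side to the next: points at the same scale on both sides of a
  -- triangle have images whose distance tends to zero.
  have hall : ∀ i ≤ m, Tendsto (fun n : ℕ => ψ (c n • x i)) atTop (𝓝 p) := by
    intro i
    induction i with
    | zero => exact fun _ => hp
    | succ i ih =>
      intro hi
      refine (ih (by omega)).congr_dist ?_
      have : ∀ n, dist (ψ (c n • x i)) (ψ (c n • x (i + 1))) = dist (c n • x i) (c n • x (i + 1)) :=
        fun n => hψ i hi _ (meml n i) _ (memr n i) (ne n (by omega)) (ne n hi)
      simp only [this]
      simpa using (hcx (x i)).dist (hcx (x (i + 1)))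
  refine ⟨p, hall, fun i hi a ha ha0 => ?_⟩
  have h1 : Tendsto (fun n => dist (ψ a) (ψ (c n • x i))) atTop (𝓝 (dist (ψ a) p)) :=
    tendsto_const_nhds.dist (hall i hi.le)
  have h2 : Tendsto (fun n => dist a (c n • x i)) atTop (𝓝 (dist a 0)) :=
    tendsto_const_nhds.dist (hcx (x i))
  rw [← dist_zero_right a]
  refine tendsto_nhds_unique h1 (h2.congr fun n => ?_)
  exact (hψ i hi _ ha _ (meml n i) ha0 (ne n hi.le)).symm

/-- A linear isometry of the plane onto `ℂ` that takes an open half plane to the right half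
plane. -/
theorem exists_isometry_re_pos (f : Plane2 →L[ℝ] ℝ) (hf : f ≠ 0) :
    ∃ g : Plane2 →ₗᵢ[ℝ] ℂ, ∀ p, 0 < f p → 0 < (g p).re := by
  obtain ⟨n, hn⟩ : ∃ n : Plane2, ∀ p, f p = inner ℝ n p :=
    ⟨(InnerProductSpace.toDual ℝ Plane2).symm f, fun p => by simp⟩
  set J := Complex.orthonormalBasisOneI.repr.symm
  have hn0 : J n ≠ 0 := by
    intro h
    have : n = 0 := by simpa using h
    exact hf (by ext p; simp [hn, this])
  -- Multiplication by this unit complex number rotates the normal vector of the half plane onto the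
  -- positive real axis.
  set w : ℂ := (starRingEnd ℂ) (J n) / ‖J n‖
  have hw : ‖w‖ = 1 := by
    have : n ≠ 0 := fun h => hn0 (by simp [h])
    simp [w, this]
  refine ⟨⟨(LinearMap.mulLeft ℝ w).comp J.toLinearEquiv.toLinearMap, fun p => by simp [hw]⟩,
    fun p hp => ?_⟩
  have : f p = inner ℝ (J n) (J p) := by rw [hn, J.inner_map_map]
  rw [this, Complex.inner] at hp
  have e : w * J p = ((1 / ‖J n‖ : ℝ) : ℂ) * ((starRingEnd ℂ) (J n) * J p) := by
    simp only [w]; push_cast; ring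
  change 0 < (w * J p).re
  rw [e, Complex.re_ofReal_mul]
  have : 0 < ‖J n‖ := norm_pos_iff.2 hn0
  have h2 : 0 < ((starRingEnd ℂ) (J n) * J p).re := by simpa [mul_comm] using hp
  positivity

/-- The total angle of a fan around the end of a cut is less than `π` if the surface is flattened
onto a convex region. -/
theorem IsFan.not_flattensOnto {Q T : Set Space3} {P : Set Plane2} {v d : Space3} {m : ℕ}
    {x : ℕ → Space3} (h : IsFan Q v d m x) (hv : v ∈ T) {ε : ℝ} (hε : 0 < ε)
    (hT : ∀ y ∈ T, dist y v < ε → ∃ r : ℝ, 0 ≤ r ∧ y = v + r • d) (hP : Convex ℝ P)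
    (hflat : FlattensOnto Q T P) : False := by
  obtain ⟨x, h, hsmall⟩ := h.exists_small hε
  obtain ⟨φ, hφ⟩ := hflat
  have hm : 0 < m := by
    rcases Nat.eq_zero_or_pos m with rfl | hm
    · exact absurd h.angle (by simpa using Real.pi_pos)
    · exact hm
  have hx : ∀ i ≤ m, x i ≠ 0 := by
    intro i hi h0
    rcases hi.lt_or_eq with hi | rfl
    · simpa using (h.pointed i hi 1 0 zero_le_one le_rfl (by simp [h0])).1
    · obtain ⟨k, rfl⟩ : ∃ k, i = k + 1 := ⟨i - 1, by omega⟩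
      simpa using (h.pointed k (by omega) 0 1 le_rfl zero_le_one (by simp [h0])).2
  have hmem : ∀ i < m, ∀ z ∈ wedge (x i) (x (i + 1)), z ≠ 0 → v + z ∈ frontier Q \ T := by
    intro i hi z hz hz0
    refine ⟨h.mem i hi z hz, fun hzT => ?_⟩
    obtain ⟨r, hr, hzr⟩ := hT _ hzT (by simpa using hsmall i hi z hz)
    obtain ⟨a, b, ha, hb, hab, rfl⟩ := hz
    obtain ⟨rfl, rfl⟩ := h.avoid i hi a b r ha hb hr (add_left_cancel hzr)
    simp at hz0
  classical
  -- The value `0` off the cut surface is a dummy; `ψ` is used only at nonzero vectors of the fan.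
  set ψ : Space3 → Plane2 := fun z => if hz : v + z ∈ frontier Q \ T then φ ⟨v + z, hz⟩ else 0
  have hψmem : ∀ z (hz : v + z ∈ frontier Q \ T), ψ z = φ ⟨v + z, hz⟩ := fun z hz => dif_pos hz
  have hψ : ∀ i < m, ∀ a ∈ wedge (x i) (x (i + 1)), ∀ b ∈ wedge (x i) (x (i + 1)), a ≠ 0 → b ≠ 0 →
      dist (ψ a) (ψ b) = dist a b := by
    intro i hi a ha b hb ha0 hb0
    rw [hψmem a (hmem i hi a ha ha0), hψmem b (hmem i hi b hb hb0), ← Subtype.dist_eq, hφ]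
    · simp [Subtype.dist_eq]
    · intro w hw
      rw [← segment_translate_image] at hw
      obtain ⟨w, hw, rfl⟩ := hw
      refine hmem i hi w (convex_wedge.segment_subset ha hb hw) ?_
      rintro rfl
      exact (h.pointed i hi).zero_notMem_segment ha hb ha0 hb0 hw
  obtain ⟨p, hlim, hdist⟩ := exists_apex hm hx hψ
  -- the apex is not an interior point of the flattened surface
  have hp : p ∉ interior P := by
    intro hp
    set c : ℕ → ℝ := fun n => 1 / ((n : ℝ) + 1)
    have hc0 : ∀ n, 0 < c n := fun n => by positivity
    have hc1 : ∀ n, c n ≤ 1 := fun n => by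
      simp only [c]; rw [div_le_one (by positivity)]; linarith [n.cast_nonneg (α := ℝ)]
    have hm0 : ∀ n, v + c n • x 0 ∈ frontier Q \ T := fun n =>
      hmem 0 hm _ (smul_mem_wedge left_mem_wedge (hc0 n).le (hc1 n))
        (smul_ne_zero (hc0 n).ne' (hx 0 hm.le))
    have h1 : Tendsto (fun n => φ ⟨v + c n • x 0, hm0 n⟩) atTop (𝓝 ⟨p, hp⟩) := by
      rw [tendsto_subtype_rng]
      refine (hlim 0 hm.le).congr fun n => ?_
      exact hψmem _ (hm0 n)
    -- Pulled back to the surface, the sequence converges to a point outside `T`, but by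
    -- construction it converges to `v`, which lies in `T`.
    have h2 := (φ.symm.continuous.tendsto _).comp h1
    have h3 : Tendsto (fun n => v + c n • x 0) atTop (𝓝 (φ.symm ⟨p, hp⟩ : Space3)) := by
      refine ((continuous_subtype_val.tendsto _).comp h2).congr fun n => ?_
      simp
    have h4 : Tendsto (fun n => v + c n • x 0) atTop (𝓝 v) := by
      have : Tendsto c atTop (𝓝 0) := tendsto_one_div_add_atTop_nhds_zero_nat
      simpa using tendsto_const_nhds.add (this.smul_const (x 0))
    exact (φ.symm ⟨p, hp⟩).2.2 (tendsto_nhds_unique h3 h4 ▸ hv)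
  -- Convexity enters here: a line through `p` has the whole interior strictly on one side.
  obtain ⟨f, hf⟩ := geometric_hahn_banach_point_open hP.interior isOpen_interior hp
  have hf0 : f ≠ 0 := by
    rintro rfl
    have := hf (ψ (x 0)) (by
      rw [hψmem _ (hmem 0 hm _ left_mem_wedge (hx 0 hm.le))]
      exact (φ _).2)
    simp at this
  obtain ⟨g, hg⟩ := exists_isometry_re_pos f hf0
  set u : Space3 → ℂ := fun z => if z = 0 then 0 else g (ψ z - p)
  have hune : ∀ z, z ≠ 0 → u z = g (ψ z - p) := fun z hz => if_neg hz
  have hu0 : u 0 = 0 := if_pos rfl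
  refine absurd h.angle (not_le.2 (sum_angle_lt_pi hu0 h.pointed ?_ ?_ ?_ h.adj))
  · intro i hi a ha b hb
    rcases eq_or_ne a 0 with rfl | ha0 <;> rcases eq_or_ne b 0 with rfl | hb0
    · simp
    · rw [hu0, hune b hb0, dist_zero_left, g.norm_map, ← dist_eq_norm, hdist i hi b hb hb0,
        dist_zero_left]
    · rw [hu0, hune a ha0, dist_zero_right, g.norm_map, ← dist_eq_norm, hdist i hi a ha ha0,
        dist_zero_right]
    · rw [hune a ha0, hune b hb0, g.dist_map, dist_sub_right, hψ i hi a ha b hb ha0 hb0]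
  · intro i hi a ha ha0
    rw [hune a ha0]
    refine hg _ ?_
    rw [map_sub, sub_pos]
    refine hf _ ?_
    rw [hψmem a (hmem i hi a ha ha0)]
    exact (φ _).2
  · intro i hi a ha b hb hab
    rcases eq_or_ne a 0 with rfl | ha0 <;> rcases eq_or_ne b 0 with rfl | hb0
    · rfl
    · exfalso
      rw [hu0, hune b hb0] at hab
      have := hdist (i + 1) hi b hb hb0
      rw [dist_eq_norm, ← g.norm_map, ← hab, norm_zero] at this
      exact hb0 (norm_eq_zero.1 this.symm)
    · exfalso
      rw [hu0, hune a ha0] at hab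
      have := hdist i (by omega) a ha ha0
      rw [dist_eq_norm, ← g.norm_map, hab, norm_zero] at this
      exact ha0 (norm_eq_zero.1 this.symm)
    · rw [hune a ha0, hune b hb0] at hab
      have h1 := sub_left_injective (g.injective hab)
      rw [hψmem a (hmem i (by omega) a ha ha0), hψmem b (hmem (i + 1) hi b hb hb0)] at h1
      have h2 := congrArg Subtype.val (φ.injective (Subtype.ext h1))
      exact add_left_cancel h2

/-! ### The end of a cut. -/

/-- Near a node of degree at most one, a geometric tree is contained in a ray. -/
theorem IsGeometricTree.exists_end {T : Set Space3} (hT : IsGeometricTree T) :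
    ∃ v ∈ T, ∃ (d : Space3) (ε : ℝ), 0 < ε ∧
      ∀ y ∈ T, dist y v < ε → ∃ r : ℝ, 0 ≤ r ∧ y = v + r • d := by
  obtain ⟨n, G, p, hG, hp, hcross, rfl⟩ := hT
  classical
  have hne : Nonempty (Fin n) := hG.1.nonempty
  -- an end node `i`, whose only neighbour (if there is one at all) is `j`
  obtain ⟨i, j, hij⟩ : ∃ i j : Fin n, ∀ k, G.Adj i k → k = j := by
    rcases subsingleton_or_nontrivial (Fin n) with hs | hs
    -- For a tree with a single node, `j = i` and the direction is zero.
    · exact ⟨Classical.arbitrary _, Classical.arbitrary _, fun k _ => Subsingleton.elim _ _⟩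
    · obtain ⟨i, hi⟩ := hG.exists_vert_degree_one_of_nontrivial
      obtain ⟨j, hj, hj'⟩ := SimpleGraph.degree_eq_one_iff_existsUnique_adj.1 hi
      exact ⟨i, j, hj'⟩
  refine ⟨p i, Or.inl ⟨i, rfl⟩, p j - p i, ?_⟩
  -- The part of the tree away from node `i`. It is closed and misses `p i`: a segment through `p i`
  -- would meet an edge at `i` outside their common end nodes. So some ball around `p i` sees only
  -- the edge to `j`.
  set K : Set Space3 := (p '' {k | k ≠ i}) ∪
    ⋃ (k : Fin n) (l : Fin n) (_ : G.Adj k l ∧ k ≠ i ∧ l ≠ i), segment ℝ (p k) (p l)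
  have hK : IsClosed K := by
    refine (Set.toFinite _).isClosed.union ?_
    refine isClosed_iUnion_of_finite fun k => isClosed_iUnion_of_finite fun l =>
      isClosed_iUnion_of_finite fun _ => ?_
    rw [← convexHull_pair]
    exact ((Set.toFinite _).isCompact_convexHull ℝ).isClosed
  have hiK : p i ∉ K := by
    rintro (⟨k, hk, hki⟩ | hK)
    · exact hk (hp hki)
    · simp only [Set.mem_iUnion] at hK
      obtain ⟨k, l, ⟨hkl, hki, hli⟩, hmem⟩ := hK
      have hadj : ∃ j', G.Adj i j' := by
        have : Nontrivial (Fin n) := ⟨k, i, hki⟩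
        exact hG.1.preconnected.exists_adj_of_nontrivial i
      obtain ⟨j', hj'⟩ := hadj
      have := (hcross i j' k l hj' hkl (by
        intro h
        rw [Sym2.eq_iff] at h
        rcases h with h | h
        · exact hki h.1.symm
        · exact hli h.1.symm) ⟨left_mem_segment _ _ _, hmem⟩).2
      rcases this with h | h
      · exact hki (hp h).symm
      · exact hli (hp h).symm
  obtain ⟨ε, hε, hball⟩ := Metric.isOpen_iff.1 hK.isOpen_compl _ hiK
  refine ⟨ε, hε, ?_⟩
  have hseg : ∀ y ∈ segment ℝ (p i) (p j), ∃ r : ℝ, 0 ≤ r ∧ y = p i + r • (p j - p i) := by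
    intro y hy
    rw [segment_eq_image'] at hy
    obtain ⟨r, hr, rfl⟩ := hy
    exact ⟨r, hr.1, rfl⟩
  rintro y (⟨k, rfl⟩ | hy) hd
  · have : k = i := by
      by_contra hk
      exact hball hd (Or.inl ⟨k, hk, rfl⟩)
    exact ⟨0, le_rfl, by simp [this]⟩
  · simp only [Set.mem_iUnion] at hy
    obtain ⟨k, l, hkl, hy⟩ := hy
    rcases eq_or_ne k i with rfl | hki
    · rw [hij l hkl] at hy
      exact hseg y hy
    · rcases eq_or_ne l i with rfl | hli
      · rw [hij k hkl.symm, segment_symm] at hy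
        exact hseg y hy
      · refine absurd (Or.inr ?_) (hball hd)
        simp only [Set.mem_iUnion]
        exact ⟨k, l, ⟨hkl, hki, hli⟩, hy⟩

/-- A surface that has a fan around each of its points, avoiding any given direction, has no
unfolding onto a convex polygon. -/
theorem not_hasConvexUnfolding_of_isFan {Q : Set Space3}
    (h : ∀ v ∈ frontier Q, ∀ d, ∃ m x, IsFan Q v d m x) : ¬ HasConvexUnfolding Q := by
  rintro ⟨P, ⟨⟨V, -, rfl⟩, -⟩, T, hT, hTQ, hflat⟩
  obtain ⟨v, hv, d, ε, hε, hloc⟩ := hT.exists_end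
  obtain ⟨m, x, hx⟩ := h v (hTQ hv) d
  exact hx.not_flattensOnto hv hε hloc (convex_convexHull ℝ V) hflat

/-! ### Fans at points that are not vertices. -/

theorem mem_frontier_of_inner_le {Q : Set Space3} {x n : Space3} (hx : x ∈ Q) (hn : n ≠ 0)
    (h : ∀ y ∈ Q, inner ℝ n y ≤ inner ℝ n x) : x ∈ frontier Q := by
  refine ⟨subset_closure hx, fun hxi => ?_⟩
  obtain ⟨ε, hε, hball⟩ := Metric.isOpen_iff.1 isOpen_interior x hxi
  have hn' : 0 < ‖n‖ := norm_pos_iff.2 hn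
  have hm : x + (ε / (2 * ‖n‖)) • n ∈ Q := by
    refine interior_subset (hball ?_)
    rw [Metric.mem_ball, dist_self_add_left, norm_smul, Real.norm_of_nonneg (by positivity)]
    field_simp
    linarith
  have := h _ hm
  rw [inner_add_right, real_inner_smul_right, real_inner_self_eq_norm_sq] at this
  have : 0 < ε / (2 * ‖n‖) * ‖n‖ ^ 2 := by positivity
  linarith

theorem inner_le_of_mem_convexHull {V : Set Space3} {n y : Space3} {c : ℝ}
    (h : ∀ w ∈ V, inner ℝ n w ≤ c) (hy : y ∈ convexHull ℝ V) : inner ℝ n y ≤ c :=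
  convexHull_min (t := {y | inner ℝ n y ≤ c}) h
    (convex_halfSpace_le (innerSL ℝ n).toLinearMap.isLinear c) hy

theorem IsFan.of_three {Q : Set Space3} {v d x y z : Space3} (hxy : PointedPair x y)
    (hyz : PointedPair y z) (mxy : ∀ w ∈ wedge x y, v + w ∈ frontier Q)
    (myz : ∀ w ∈ wedge y z, v + w ∈ frontier Q)
    (axy : ∀ s t r : ℝ, 0 ≤ s → 0 ≤ t → 0 ≤ r → s • x + t • y = r • d → s = 0 ∧ t = 0)
    (ayz : ∀ s t r : ℝ, 0 ≤ s → 0 ≤ t → 0 ≤ r → s • y + t • z = r • d → s = 0 ∧ t = 0)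
    (hadj : ∀ a b c d : ℝ, 0 ≤ a → 0 ≤ b → 0 ≤ c → 0 ≤ d →
      a • x + b • y = c • y + d • z → a = 0 ∧ d = 0)
    (hang : Real.pi ≤ InnerProductGeometry.angle x y + InnerProductGeometry.angle y z) :
    IsFan Q v d 2 (fun i => if i = 0 then x else if i = 1 then y else z) where
  pointed i hi := by interval_cases i <;> simpa
  mem i hi := by interval_cases i <;> simpa
  avoid i hi := by interval_cases i <;> simpa
  adj i hi := by
    obtain rfl : i = 0 := by omega
    simpa using hadj
  angle := by simpa [Finset.sum_range_succ] using hang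

/-- The determinant is `‖a‖ * ‖b‖` times the sine of the difference of arguments, which lies in [0,
π] because `a` is in the closed upper half plane. -/
theorem Complex.mul_im_sub_nonneg_of_arg_le {a b : ℂ} (ha : 0 ≤ a.im)
    (h : a.arg ≤ b.arg) : 0 ≤ a.re * b.im - a.im * b.re := by
  have e : a.re * b.im - a.im * b.re = ‖a‖ * ‖b‖ * Real.sin (b.arg - a.arg) := by
    rw [Real.sin_sub]
    have h1 := Complex.norm_mul_cos_arg a
    have h2 := Complex.norm_mul_sin_arg a
    have h3 := Complex.norm_mul_cos_arg b
    have h4 := Complex.norm_mul_sin_arg b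
    rw [← h1, ← h2, ← h3, ← h4]
    ring_nf
  rw [e]
  have := Complex.arg_nonneg_iff.2 ha
  have := Complex.arg_le_pi b
  exact mul_nonneg (by positivity)
    (Real.sin_nonneg_of_nonneg_of_le_pi (by linarith) (by linarith))

/-- A point of the surface of a polytope that is not a vertex has a fan. -/
theorem exists_isFan_of_notMem {V : Set Space3} (hV : V.Finite)
    (hint : (interior (convexHull ℝ V)).Nonempty) {v : Space3}
    (hv : v ∈ frontier (convexHull ℝ V)) (hvV : v ∉ V) (d : Space3) :
    ∃ m x, IsFan (convexHull ℝ V) v d m x := by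
  set Q := convexHull ℝ V
  have hQ : Convex ℝ Q := convex_convexHull ℝ V
  have hQc : IsClosed Q := (hV.isCompact_convexHull ℝ).isClosed
  have hvQ : v ∈ Q := hQc.frontier_subset hv
  -- functionals are not constant on the vertices
  have hconst : ∀ n : Space3, n ≠ 0 → ¬ ∀ w ∈ V, inner ℝ n w = inner ℝ n v := by
    intro n hn h
    obtain ⟨y, hy⟩ := hint
    have h1 : ∀ y ∈ Q, inner ℝ n y = inner ℝ n v := fun y hy =>
      convexHull_min (t := {y | inner ℝ n y = inner ℝ n v}) h
        (convex_hyperplane (innerSL ℝ n).toLinearMap.isLinear _) hy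
    exact (mem_frontier_of_inner_le (interior_subset hy) hn fun z hz => by
      rw [h1 z hz, h1 y (interior_subset hy)]).2 hy
  -- a supporting plane
  obtain ⟨F, hF0, hF⟩ : ∃ F : Space3, F ≠ 0 ∧ ∀ y ∈ Q, inner ℝ F y ≤ inner ℝ F v := by
    obtain ⟨f, hf⟩ := geometric_hahn_banach_open_point hQ.interior isOpen_interior hv.2
    refine ⟨(InnerProductSpace.toDual ℝ Space3).symm f, ?_, ?_⟩
    · intro h
      obtain ⟨y, hy⟩ := hint
      have : f = 0 := by simpa using h
      simpa [this] using hf y hy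
    · have h1 : closure (interior Q) ⊆ {y | f y ≤ f v} :=
        closure_minimal (fun y hy => (hf y hy).le) (isClosed_le f.continuous continuous_const)
      intro y hy
      rw [hQ.closure_interior_eq_closure_of_nonempty_interior hint] at h1
      simpa using h1 (subset_closure hy)
  -- a segment around the point
  obtain ⟨e, he0, hep, hem⟩ : ∃ e : Space3, e ≠ 0 ∧ v + e ∈ Q ∧ v - e ∈ Q := by
    have h1 : v ∉ Q.extremePoints ℝ := fun h => hvV (extremePoints_convexHull_subset h)
    rw [mem_extremePoints] at h1
    push Not at h1
    obtain ⟨x₁, hx₁, x₂, hx₂, ⟨a, b, ha, hb, hab, hvx⟩, hne⟩ := h1 hvQ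
    have hx : x₁ ≠ x₂ := by
      rintro rfl
      have : x₁ = v := by rw [← hvx, ← add_smul, hab, one_smul]
      exact hne this this
    set c := min a b
    have hc : 0 < c := lt_min ha hb
    have hca : c ≤ a := min_le_left _ _
    have hcb : c ≤ b := min_le_right _ _
    refine ⟨c • (x₂ - x₁), smul_ne_zero hc.ne' (sub_ne_zero.2 hx.symm), ?_, ?_⟩
    · have := hQ hx₁ hx₂ (sub_nonneg.2 hca) (by positivity : 0 ≤ b + c) (by linarith)
      convert this using 1
      rw [← hvx]; module
    · have := hQ hx₁ hx₂ (by positivity : 0 ≤ a + c) (sub_nonneg.2 hcb) (by linarith)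
      convert this using 1
      rw [← hvx]; module
  have hFe : inner ℝ F e = 0 := by
    have h1 := hF _ hep
    have h2 := hF _ hem
    rw [inner_add_right] at h1
    rw [inner_sub_right] at h2
    linarith
  obtain ⟨G, hG0, hGe, hGF⟩ : ∃ G : Space3, G ≠ 0 ∧ inner ℝ G e = 0 ∧ inner ℝ G F = 0 := by
    have h1 : Module.finrank ℝ (Submodule.span ℝ ({e, F} : Set Space3)) < 3 := by
      classical
      have := finrank_span_finset_le_card (R := ℝ) ({e, F} : Finset Space3)
      rw [Finset.coe_pair] at this
      exact (this.trans Finset.card_le_two).trans_lt (by norm_num)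
    have h2 : (Submodule.span ℝ ({e, F} : Set Space3))ᗮ ≠ ⊥ := by
      rw [Ne, Submodule.orthogonal_eq_bot_iff]
      intro h
      rw [h, finrank_top] at h1
      simp at h1
    obtain ⟨G, hG, hG0⟩ := Submodule.exists_mem_ne_zero_of_ne_bot h2
    rw [Submodule.mem_orthogonal'] at hG
    exact ⟨G, hG0, hG e (Submodule.subset_span (by simp)), hG F (Submodule.subset_span (by simp))⟩
  -- Projection along `e` onto a plane. The sign of the second coordinate puts the polytope in the
  -- closed upper half plane, so the arguments that occur lie in [0, π].
  set z : Space3 → ℂ := fun a => ⟨inner ℝ G a, -inner ℝ F a⟩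
  have zadd : ∀ a b, z (a + b) = z a + z b := fun a b => by
    apply Complex.ext <;> simp [z, inner_add_right]; ring
  have zsmul : ∀ (c : ℝ) a, z (c • a) = c • z a := fun c a => by
    apply Complex.ext <;> simp [z, real_inner_smul_right]
  have ze : z e = 0 := by apply Complex.ext <;> simp [z, hGe, hFe]
  have zim : ∀ w ∈ V, 0 ≤ (z (w - v)).im := fun w hw => by
    have := hF w (subset_convexHull ℝ V hw)
    simp only [z, inner_sub_right]
    linarith
  -- the functional that vanishes on the plane spanned by `e` and a vector `a`
  set N : Space3 → Space3 := fun a => (z a).re • F + (z a).im • G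
  have hN : ∀ a b, inner ℝ (N a) b = (z a).im * (z b).re - (z a).re * (z b).im := fun a b => by
    simp only [N, z, inner_add_left, real_inner_smul_left]; ring
  have hN0 : ∀ a, z a ≠ 0 → N a ≠ 0 := by
    intro a ha h
    have h1 : inner ℝ (N a) F = 0 := by rw [h, inner_zero_left]
    have h2 : inner ℝ (N a) G = 0 := by rw [h, inner_zero_left]
    simp only [N, inner_add_left, real_inner_smul_left, hGF, real_inner_comm G F, mul_zero,
      add_zero, zero_add, mul_eq_zero, inner_self_eq_zero, hF0, hG0, or_false] at h1 h2
    exact ha (Complex.ext h1 h2)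
  set A : Set Space3 := {w ∈ V | z (w - v) ≠ 0}
  have hA : A.Finite := hV.subset fun w hw => hw.1
  have hAne : A.Nonempty := by
    by_contra hA0
    rw [Set.not_nonempty_iff_eq_empty] at hA0
    refine hconst F hF0 fun w hw => ?_
    have h1 : z (w - v) = 0 := by
      by_contra hne
      exact (Set.eq_empty_iff_forall_notMem.1 hA0 w) ⟨hw, hne⟩
    have h2 : (z (w - v)).im = 0 := by rw [h1, Complex.zero_im]
    simp only [z, inner_sub_right] at h2
    linarith
  -- The extreme arguments give two supporting planes through the line `v + ℝ e`. They coincide when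
  -- `v` is interior to a face.
  obtain ⟨p₁, hp₁, hmin⟩ := Set.exists_min_image A (fun w => (z (w - v)).arg) hA hAne
  obtain ⟨p₂, hp₂, hmax⟩ := Set.exists_max_image A (fun w => (z (w - v)).arg) hA hAne
  have hle₁ : ∀ w ∈ V, inner ℝ (N (p₁ - v)) w ≤ inner ℝ (N (p₁ - v)) v := by
    intro w hw
    rw [← sub_nonpos, ← inner_sub_right, hN]
    by_cases h0 : z (w - v) = 0
    · simp [h0]
    · have := Complex.mul_im_sub_nonneg_of_arg_le (zim p₁ hp₁.1) (hmin w ⟨hw, h0⟩)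
      linarith
  have hle₂ : ∀ w ∈ V, inner ℝ (-N (p₂ - v)) w ≤ inner ℝ (-N (p₂ - v)) v := by
    intro w hw
    rw [← sub_nonpos, ← inner_sub_right, inner_neg_left, hN]
    by_cases h0 : z (w - v) = 0
    · simp [h0]
    · have := Complex.mul_im_sub_nonneg_of_arg_le (zim w hw) (hmax w ⟨hw, h0⟩)
      linarith
  -- If the extreme arguments agreed, all vertices would lie in one plane and the polytope would be
  -- flat.
  have hlt : (z (p₁ - v)).arg < (z (p₂ - v)).arg := by
    refine lt_of_le_of_ne (hmin p₂ hp₂) fun heq => ?_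
    refine hconst (N (p₁ - v)) (hN0 _ hp₁.2) fun w hw => le_antisymm (hle₁ w hw) ?_
    rw [← sub_nonneg, ← inner_sub_right, hN]
    by_cases h0 : z (w - v) = 0
    · simp [h0]
    · have := Complex.mul_im_sub_nonneg_of_arg_le (zim w hw)
        ((hmax w ⟨hw, h0⟩).trans heq.ge)
      linarith
  -- directions orthogonal to `e` on both sides
  have side : ∀ p ∈ V, z (p - v) ≠ 0 → ∀ M : Space3, M ≠ 0 → inner ℝ M e = 0 →
      inner ℝ M (p - v) = 0 → (∀ w ∈ V, inner ℝ M w ≤ inner ℝ M v) →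
      ∃ (w : Space3) (c : ℝ), 0 < c ∧ z w = c • z (p - v) ∧ inner ℝ w e = 0 ∧
        (∀ y ∈ wedge e w, v + y ∈ frontier Q) ∧ ∀ y ∈ wedge w (-e), v + y ∈ frontier Q := by
    intro p hp hz0 M hM hMe hMp hMle
    have hee : 0 < inner ℝ e e := real_inner_self_pos.2 he0
    -- Subtracting `q • e` makes the direction orthogonal to `e`; the factor `c` makes `v + w` a
    -- convex combination of `p` and `v ± e` (or `v` if `q = 0`), hence a point of the polytope.
    set q := inner ℝ (p - v) e / inner ℝ e e
    set c : ℝ := 1 / (1 + |q|)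
    have hc : 0 < c := by positivity
    have hcq : c * |q| = 1 - c := by simp only [c]; field_simp; ring
    set w := c • (p - v - q • e)
    have hwQ : v + w ∈ Q := by
      have h1 : v + (-(SignType.sign q : ℝ)) • e ∈ Q := by
        rcases lt_trichotomy q 0 with h | h | h
        · simpa [sign_neg h] using hep
        · simpa [h] using hvQ
        · simpa [sign_pos h, sub_eq_add_neg] using hem
      have h2 := hQ (subset_convexHull ℝ V hp) h1 hc.le (by rw [← hcq]; positivity : 0 ≤ 1 - c)
        (by ring)
      convert h2 using 1
      rw [← hcq]
      have : |q| * (-(SignType.sign q : ℝ)) = -q := by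
        rw [mul_neg, mul_comm, sign_mul_abs]
      have h3 : (c * |q|) • (v + (-(SignType.sign q : ℝ)) • e)
          = (1 - c) • v + (c * (|q| * (-(SignType.sign q : ℝ)))) • e := by
        rw [smul_add, hcq, ← hcq, smul_smul, mul_assoc]
      rw [h3, this]
      simp only [w]
      module
    have hMw : inner ℝ M w = 0 := by
      simp only [w, real_inner_smul_right, inner_sub_right] at hMp ⊢
      rw [hMe, hMp]; simp
    have tri : ∀ x y, v + x ∈ Q → v + y ∈ Q → inner ℝ M x = 0 → inner ℝ M y = 0 →
        ∀ u ∈ wedge x y, v + u ∈ frontier Q := by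
      rintro x y hx hy hMx hMy _ ⟨s, t, hs, ht, hst, rfl⟩
      refine mem_frontier_of_inner_le (n := M) ?_ hM fun u hu => ?_
      · exact wedge_subset_of_convex (hQ.translate_preimage_right v) (by simpa using hvQ) hx hy
          ⟨s, t, hs, ht, hst, rfl⟩
      · have := inner_le_of_mem_convexHull hMle hu
        simpa [inner_add_right, real_inner_smul_right, hMx, hMy] using this
    refine ⟨w, c, hc, ?_, ?_, tri e w hep hwQ hMe hMw,
      tri w (-e) hwQ (by simpa [sub_eq_add_neg] using hem) hMw (by simp [hMe])⟩
    · have : z (p - v) = z (p - v - q • e) + q • z e := by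
        rw [← zsmul, ← zadd, sub_add_cancel]
      simp only [w]
      rw [zsmul, this, ze, smul_zero, add_zero]
    · simp only [w, real_inner_smul_left, inner_sub_left, q]
      rw [div_mul_cancel₀ _ hee.ne', sub_self, mul_zero]
  have hNe : ∀ a, inner ℝ (N a) e = 0 := fun a => by rw [hN, ze]; simp
  have hNa : ∀ a, inner ℝ (N a) a = 0 := fun a => by rw [hN]; ring
  obtain ⟨w₁, c₁, hc₁, hz₁, hwe₁, hm₁, hm₁'⟩ := side p₁ hp₁.1 hp₁.2 (N (p₁ - v)) (hN0 _ hp₁.2)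
    (hNe _) (hNa _) hle₁
  obtain ⟨w₂, c₂, hc₂, hz₂, hwe₂, hm₂, hm₂'⟩ := side p₂ hp₂.1 hp₂.2 (-N (p₂ - v))
    (neg_ne_zero.2 (hN0 _ hp₂.2)) (by rw [inner_neg_left, hNe, neg_zero])
    (by rw [inner_neg_left, hNa, neg_zero]) hle₂
  have hzw₁ : z w₁ ≠ 0 := hz₁ ▸ smul_ne_zero hc₁.ne' hp₁.2
  have hzw₂ : z w₂ ≠ 0 := hz₂ ▸ smul_ne_zero hc₂.ne' hp₂.2
  have harg : (z w₁).arg ≠ (z w₂).arg := by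
    rw [hz₁, hz₂, Complex.real_smul, Complex.real_smul, Complex.arg_real_mul _ hc₁,
      Complex.arg_real_mul _ hc₂]
    exact hlt.ne
  have sep : ∀ s t : ℝ, 0 ≤ s → 0 ≤ t → s • z w₁ = t • z w₂ → s = 0 ∧ t = 0 := by
    intro s t hs ht h
    rcases hs.eq_or_lt with rfl | hs
    · simpa [hzw₂] using h.symm
    · rcases ht.eq_or_lt with rfl | ht
      · simpa [hzw₁] using h
      · refine absurd ?_ harg
        rw [← Complex.arg_real_mul (z w₁) hs, ← Complex.arg_real_mul (z w₂) ht,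
          ← Complex.real_smul, ← Complex.real_smul, h]
  have lin : ∀ w, z w ≠ 0 → ∀ s t : ℝ, s • e + t • w = 0 → s = 0 ∧ t = 0 := by
    intro w hw s t h
    have h1 := congrArg z h
    rw [zadd, zsmul, zsmul, ze, smul_zero, zero_add] at h1
    have ht : t = 0 := by
      have : z 0 = 0 := by apply Complex.ext <;> simp [z]
      simpa [this, hw] using h1
    subst ht
    simpa [he0] using h
  -- The triangles on `e, w` and `w, -e` fill a straight angle at `v`, which serves if the ray
  -- misses this half plane.
  have half : ∀ w, z w ≠ 0 → (∀ y ∈ wedge e w, v + y ∈ frontier Q) →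
      (∀ y ∈ wedge w (-e), v + y ∈ frontier Q) →
      (∀ s t r : ℝ, 0 ≤ t → 0 ≤ r → s • e + t • w = r • d → s = 0 ∧ t = 0) →
      ∃ m x, IsFan Q v d m x := by
    intro w hw h1 h2 h3
    refine ⟨_, _, IsFan.of_three (fun s t _ _ h => lin w hw s t h) ?_ h1 h2
      (fun s t r _ ht hr h => h3 s t r ht hr h) ?_ ?_ ?_⟩
    · intro s t _ _ h
      obtain ⟨h4, h5⟩ := lin w hw (-t) s (by rw [← h]; module)
      exact ⟨h5, neg_eq_zero.1 h4⟩
    · intro s t r hs _ hr h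
      obtain ⟨h4, h5⟩ := h3 (-t) s r hs hr (by rw [← h]; module)
      exact ⟨h5, neg_eq_zero.1 h4⟩
    · intro a b c f ha _ _ hf h
      obtain ⟨h4, -⟩ := lin w hw (a + f) (b - c) (by
        rw [← sub_eq_zero] at h; rw [← h]; module)
      exact ⟨by linarith, by linarith⟩
    · rw [InnerProductGeometry.angle_neg_right, InnerProductGeometry.angle_comm w e]
      linarith
  by_cases hd₁ : ∀ s t r : ℝ, 0 ≤ t → 0 ≤ r → s • e + t • w₁ = r • d → s = 0 ∧ t = 0
  · exact half w₁ hzw₁ hm₁ hm₁' hd₁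
  by_cases hd₂ : ∀ s t r : ℝ, 0 ≤ t → 0 ≤ r → s • e + t • w₂ = r • d → s = 0 ∧ t = 0
  · exact half w₂ hzw₂ hm₂ hm₂' hd₂
  -- the remaining case: the ray runs along the segment
  obtain ⟨σ, hσ0, hσ⟩ : ∃ σ : ℝ, σ ≠ 0 ∧ d = σ • e := by
    push Not at hd₁ hd₂
    obtain ⟨s₁, t₁, r₁, ht₁, hr₁, h₁, hn₁⟩ := hd₁
    obtain ⟨s₂, t₂, r₂, ht₂, hr₂, h₂, hn₂⟩ := hd₂
    have hr₁' : r₁ ≠ 0 := by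
      rintro rfl
      obtain ⟨h3, h4⟩ := lin w₁ hzw₁ s₁ t₁ (by simpa using h₁)
      exact hn₁ h3 h4
    have hr₂' : r₂ ≠ 0 := by
      rintro rfl
      obtain ⟨h3, h4⟩ := lin w₂ hzw₂ s₂ t₂ (by simpa using h₂)
      exact hn₂ h3 h4
    have e₁ : t₁ • z w₁ = r₁ • z d := by
      rw [← zsmul r₁, ← h₁, zadd, zsmul, zsmul, ze, smul_zero, zero_add]
    have e₂ : t₂ • z w₂ = r₂ • z d := by
      rw [← zsmul r₂, ← h₂, zadd, zsmul, zsmul, ze, smul_zero, zero_add]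
    obtain ⟨h3, -⟩ := sep (r₂ * t₁) (r₁ * t₂) (by positivity) (by positivity) (by
      rw [mul_smul, mul_smul, e₁, e₂, smul_comm])
    have ht : t₁ = 0 := by simpa [hr₂'] using h3
    subst ht
    refine ⟨s₁ / r₁, div_ne_zero (fun h => hn₁ h rfl) hr₁', ?_⟩
    rw [zero_smul, add_zero] at h₁
    rw [div_eq_inv_mul, mul_smul, h₁, inv_smul_smul₀ hr₁']
  -- The vector `τ • e` points away from the ray. With `w₁` and `w₂`, both orthogonal to `e`, it
  -- spans two right angles.
  have cross : ∀ τ : ℝ, τ ≠ 0 → τ * σ < 0 → (∀ y ∈ wedge w₁ (τ • e), v + y ∈ frontier Q) →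
      (∀ y ∈ wedge (τ • e) w₂, v + y ∈ frontier Q) → ∃ m x, IsFan Q v d m x := by
    intro τ hτ hτσ h1 h2
    have av : ∀ w, z w ≠ 0 → ∀ s t r : ℝ, 0 ≤ t → 0 ≤ r → s • w + t • (τ • e) = r • d →
        s = 0 ∧ t = 0 := by
      intro w hw s t r ht hr h
      obtain ⟨h3, h4⟩ := lin w hw (t * τ - r * σ) s (by
        rw [hσ, ← sub_eq_zero] at h; rw [← h]; module)
      refine ⟨h4, ?_⟩
      have h5 : t * τ ^ 2 = r * (τ * σ) := by linear_combination τ * h3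
      have h6 : 0 < τ ^ 2 := by positivity
      have h7 : t * τ ^ 2 ≤ 0 := by rw [h5]; exact mul_nonpos_of_nonneg_of_nonpos hr hτσ.le
      nlinarith
    refine ⟨_, _, IsFan.of_three (fun s t hs ht h => av w₁ hzw₁ s t 0 ht le_rfl (by simpa using h))
      (fun s t hs ht h => (av w₂ hzw₂ t s 0 hs le_rfl (by rw [add_comm]; simpa using h)).symm) h1 h2
      (fun s t r hs ht hr h => av w₁ hzw₁ s t r ht hr h)
      (fun s t r hs ht hr h => (av w₂ hzw₂ t s r hs hr (by rw [add_comm]; exact h)).symm) ?_ ?_⟩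
    · intro a b c f ha hb hc hf h
      have h3 := congrArg z h
      simp only [zadd, zsmul, ze, smul_zero, add_zero, zero_add] at h3
      exact sep a f ha hf h3
    · have h3 : InnerProductGeometry.angle w₁ (τ • e) = Real.pi / 2 := by
        rw [← InnerProductGeometry.inner_eq_zero_iff_angle_eq_pi_div_two, real_inner_smul_right,
          hwe₁, mul_zero]
      have h4 : InnerProductGeometry.angle (τ • e) w₂ = Real.pi / 2 := by
        rw [← InnerProductGeometry.inner_eq_zero_iff_angle_eq_pi_div_two, real_inner_smul_left,
          real_inner_comm, hwe₂, mul_zero]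
      rw [h3, h4]; linarith
  rcases hσ0.lt_or_gt with h | h
  · exact cross 1 one_ne_zero (by linarith) (by rw [one_smul, wedge_comm]; exact hm₁)
      (by rw [one_smul]; exact hm₂)
  · exact cross (-1) (by norm_num) (by linarith) (by rw [neg_one_smul]; exact hm₁')
      (by rw [neg_one_smul, wedge_comm]; exact hm₂')

/-! ### Fans at vertices. -/

/-- The corner of a polytope with vertex set `V` at the vertex `v`, with `k` congruent faces: the
neighbouring vertices are `v + e i`, in cyclic order, and `n i` is an outer normal vector of the
face that contains `v + e i` and `v + e (i + 1)`. The total angle of all faces but one is at least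
`π`. -/
structure IsPolyhedralCorner (V : Set Space3) (v : Space3) (k : ℕ) (e n : ZMod k → Space3) : Prop where
  mem : v ∈ V
  mem_e : ∀ i, v + e i ∈ V
  le : ∀ i, ∀ w ∈ V, inner ℝ (n i) w ≤ inner ℝ (n i) v
  inner_eq : ∀ i, inner ℝ (n i) (e i) = 0
  inner_eq' : ∀ i, inner ℝ (n i) (e (i + 1)) = 0
  inner_lt : ∀ i j, j ≠ i → j ≠ i + 1 → inner ℝ (n i) (e j) < 0
  norm_eq : ∀ i, ‖e i‖ = ‖e (i + 1)‖
  angle : ∀ i, Real.pi / (k - 1) ≤ InnerProductGeometry.angle (e i) (e (i + 1))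

theorem ZMod.one_ne_zero_two_ne_zero {k : ℕ} (hk : 3 ≤ k) : (1 : ZMod k) ≠ 0 ∧ (2 : ZMod k) ≠ 0 := by
  constructor
  · have := (ZMod.natCast_eq_zero_iff 1 k).not.2 (fun h => by have := Nat.le_of_dvd one_pos h; omega)
    simpa using this
  · have := (ZMod.natCast_eq_zero_iff 2 k).not.2 (fun h => by have := Nat.le_of_dvd two_pos h; omega)
    simpa using this

/-- The midpoint of two vectors of equal length halves their angle. -/
theorem half_angle_le {E : Type*} [NormedAddCommGroup E] [InnerProductSpace ℝ E] {x y : E}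
    (h : ‖x‖ = ‖y‖) :
    InnerProductGeometry.angle x y / 2 ≤
      InnerProductGeometry.angle ((1 / 2 : ℝ) • x + (1 / 2 : ℝ) • y) y := by
  have h1 : InnerProductGeometry.angle ((1 / 2 : ℝ) • x + (1 / 2 : ℝ) • y) x =
      InnerProductGeometry.angle ((1 / 2 : ℝ) • x + (1 / 2 : ℝ) • y) y := by
    unfold InnerProductGeometry.angle
    rw [h]
    congr 2
    simp only [inner_add_left, real_inner_smul_left, real_inner_self_eq_norm_sq, h,
      real_inner_comm x y]
    ring
  have h2 := InnerProductGeometry.angle_le_angle_add_angle x ((1 / 2 : ℝ) • x + (1 / 2 : ℝ) • y) y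
  rw [InnerProductGeometry.angle_comm x ((1 / 2 : ℝ) • x + _), h1] at h2
  linarith

section

variable {V : Set Space3} {v : Space3} {k : ℕ} {e n : ZMod k → Space3}

/-- Each neighbouring face contains exactly one of the two edges, so pairing with its normal
isolates the coefficient of the other. -/
theorem IsPolyhedralCorner.indep (h : IsPolyhedralCorner V v k e n) (hk : 3 ≤ k) (q : ZMod k) {a b : ℝ}
    (h0 : a • e q + b • e (q + 1) = 0) : a = 0 ∧ b = 0 := by
  obtain ⟨k1, k2⟩ := ZMod.one_ne_zero_two_ne_zero hk
  have h1 := congrArg (inner ℝ (n (q + 1))) h0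
  have h2 := congrArg (inner ℝ (n (q - 1))) h0
  have h3 := h.inner_lt (q + 1) q (by simpa using k1) (by
    rw [add_assoc, one_add_one_eq_two]; simpa using k2)
  have h4 := h.inner_lt (q - 1) (q + 1) (fun h => k2 (by linear_combination h))
    (fun h => k1 (by linear_combination h))
  have h5 := h.inner_eq (q + 1)
  have h6 := h.inner_eq' (q - 1)
  rw [sub_add_cancel] at h6
  rw [inner_add_right, real_inner_smul_right, real_inner_smul_right, inner_zero_right] at h1 h2
  rw [h5, mul_zero, add_zero, mul_eq_zero] at h1
  rw [h6, mul_zero, zero_add, mul_eq_zero] at h2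
  exact ⟨h1.resolve_right h3.ne, h2.resolve_right h4.ne⟩

theorem IsPolyhedralCorner.inner_nonpos (h : IsPolyhedralCorner V v k e n) (i j : ZMod k) :
    inner ℝ (n i) (e j) ≤ 0 := by
  by_cases h1 : j = i
  · rw [h1, h.inner_eq]
  by_cases h2 : j = i + 1
  · rw [h2, h.inner_eq']
  exact (h.inner_lt i j h1 h2).le

/-- Different faces at a corner do not overlap. -/
theorem IsPolyhedralCorner.sector_disjoint (h : IsPolyhedralCorner V v k e n) (hk : 3 ≤ k) {q p : ZMod k} (hqp : q ≠ p)
    {S T σ τ : ℝ} (hS : 0 ≤ S) (hT : 0 ≤ T)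
    (h0 : S • e q + T • e (q + 1) = σ • e p + τ • e (p + 1)) : σ = 0 ∨ τ = 0 := by
  obtain ⟨k1, k2⟩ := ZMod.one_ne_zero_two_ne_zero hk
  -- The normal of face `p` kills the right side and is nonpositive on each term of the left, so
  -- both terms vanish. Only an edge shared with face `p` can survive.
  have h1 := congrArg (inner ℝ (n p)) h0
  simp only [inner_add_right, real_inner_smul_right, h.inner_eq, h.inner_eq', mul_zero,
    add_zero] at h1
  have h2 := mul_nonpos_of_nonneg_of_nonpos hS (h.inner_nonpos p q)
  have h3 := mul_nonpos_of_nonneg_of_nonpos hT (h.inner_nonpos p (q + 1))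
  have h4 : S * inner ℝ (n p) (e q) = 0 := by linarith
  have h5 : T * inner ℝ (n p) (e (q + 1)) = 0 := by linarith
  by_cases hq : q = p + 1
  · have hT0 : T = 0 := (mul_eq_zero.1 h5).resolve_right (h.inner_lt p (q + 1)
      (fun h => k2 (by rw [hq] at h; linear_combination h))
      (fun h => k1 (by rw [hq] at h; linear_combination h))).ne
    subst hT0
    subst hq
    left
    have := h.indep hk p (a := σ) (b := τ - S) (by
      rw [← sub_eq_zero] at h0; rw [← neg_eq_zero, ← h0]; module)
    exact this.1
  · have hS0 : S = 0 := (mul_eq_zero.1 h4).resolve_right (h.inner_lt p q hqp hq).ne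
    subst hS0
    by_cases hq1 : q + 1 = p
    · right
      rw [hq1] at h0
      have := h.indep hk p (a := σ - T) (b := τ) (by
        rw [← sub_eq_zero] at h0; rw [← neg_eq_zero, ← h0]; module)
      exact this.2
    · have hT0 : T = 0 := (mul_eq_zero.1 h5).resolve_right
        (h.inner_lt p (q + 1) hq1 (fun h => hqp (add_right_cancel h))).ne
      subst hT0
      left
      have := h.indep hk p (a := σ) (b := τ) (by rw [← h0]; simp)
      exact this.1

theorem IsPolyhedralCorner.normal_ne_zero (h : IsPolyhedralCorner V v k e n) (hk : 3 ≤ k) (i : ZMod k) : n i ≠ 0 := by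
  obtain ⟨k1, k2⟩ := ZMod.one_ne_zero_two_ne_zero hk
  intro h0
  have := h.inner_lt i (i + 2) (by simpa using k2) (fun h => k1 (by linear_combination h))
  simp [h0] at this

theorem IsPolyhedralCorner.mem_frontier (h : IsPolyhedralCorner V v k e n) (hk : 3 ≤ k) {q : ZMod k} {z : Space3}
    (hz : z ∈ wedge (e q) (e (q + 1))) : v + z ∈ frontier (convexHull ℝ V) := by
  refine mem_frontier_of_inner_le ?_ (h.normal_ne_zero hk q) fun y hy => ?_
  · refine wedge_subset_of_convex (C := (fun z => v + z) ⁻¹' convexHull ℝ V)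
      ((convex_convexHull ℝ V).translate_preimage_right v) ?_ ?_ ?_ hz
    · simpa using subset_convexHull ℝ V h.mem
    · exact subset_convexHull ℝ V (h.mem_e q)
    · exact subset_convexHull ℝ V (h.mem_e (q + 1))
  · obtain ⟨a, b, ha, hb, hab, rfl⟩ := hz
    rw [inner_add_right, inner_add_right, real_inner_smul_right, real_inner_smul_right,
      h.inner_eq, h.inner_eq']
    simpa using inner_le_of_mem_convexHull (h.le q) hy

/-- Pieces of consecutive faces at a corner form a fan. -/
theorem IsPolyhedralCorner.isFan (h : IsPolyhedralCorner V v k e n) (hk : 3 ≤ k) {d : Space3} {m : ℕ} {x : ℕ → Space3}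
    (j : ZMod k) {A B C D : ℕ → ℝ}
    (hx : ∀ i < m, x i = A i • e (j + i) + B i • e (j + i + 1))
    (hx' : ∀ i < m, x (i + 1) = C i • e (j + i) + D i • e (j + i + 1))
    (hpos : ∀ i, 0 < A i ∧ 0 ≤ B i ∧ 0 ≤ C i ∧ 0 < D i ∧ A i + B i = 1 ∧ C i + D i = 1)
    (hmid : ∀ i, i + 1 < m → x (i + 1) = e (j + i + 1))
    (havoid : ∀ i < m, ∀ s t r : ℝ, 0 ≤ s → 0 ≤ t → 0 ≤ r →
      (s * A i + t * C i) • e (j + i) + (s * B i + t * D i) • e (j + i + 1) = r • d →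
      s = 0 ∧ t = 0)
    (hang : Real.pi ≤ ∑ i ∈ Finset.range m, InnerProductGeometry.angle (x i) (x (i + 1))) :
    IsFan (convexHull ℝ V) v d m x where
  pointed i hi s t hs ht h0 := by
    refine havoid i hi s t 0 hs ht le_rfl ?_
    rw [hx i hi, hx' i hi] at h0
    rw [zero_smul, ← h0]
    module
  mem i hi z hz := by
    obtain ⟨h1, h2, h3, h4, h5, h6⟩ := hpos i
    refine h.mem_frontier hk (q := j + i) (wedge_subset_of_convex convex_wedge zero_mem_wedge ?_ ?_ hz)
    · exact ⟨A i, B i, h1.le, h2, h5.le, hx i hi⟩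
    · exact ⟨C i, D i, h3, h4.le, h6.le, hx' i hi⟩
  avoid i hi s t r hs ht hr h0 := by
    refine havoid i hi s t r hs ht hr ?_
    rw [hx i hi, hx' i hi] at h0
    rw [← h0]
    module
  adj i hi a b c f ha hb hc hf h0 := by
    obtain ⟨k1, k2⟩ := ZMod.one_ne_zero_two_ne_zero hk
    have e1 : (j + ((i + 1 : ℕ) : ZMod k)) = j + i + 1 := by push_cast; ring
    obtain ⟨hA, -⟩ := hpos i
    obtain ⟨-, -, -, hD, -⟩ := hpos (i + 1)
    rw [hmid i hi, hx i (by omega), hx' (i + 1) hi, e1] at h0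
    -- The normal of each of the two faces kills everything except the part of the other face off
    -- the common edge.
    have h1 := congrArg (inner ℝ (n (j + i))) h0
    have h2 := congrArg (inner ℝ (n (j + i + 1))) h0
    have h3 := h.inner_lt (j + i) (j + i + 1 + 1) (fun h => k2 (by linear_combination h))
      (fun h => k1 (by linear_combination h))
    have h4 := h.inner_lt (j + i + 1) (j + i) (fun h => k1 (by linear_combination -h))
      (fun h => k2 (by linear_combination -h))
    simp only [inner_add_right, real_inner_smul_right, h.inner_eq, h.inner_eq', mul_zero,
      add_zero, zero_add] at h1 h2
    constructor
    · simpa [hA.ne', h4.ne] using h2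
    · simpa [hD.ne', h3.ne] using h1.symm
  angle := hang

/-- A ray along an edge is avoided by halving the two faces at this edge. Otherwise one whole face
is left out: the one containing the ray in its interior, or an arbitrary one. Either way `k - 1`
face angles remain, each at least `π / (k - 1)`. -/
theorem IsPolyhedralCorner.exists_isFan (h : IsPolyhedralCorner V v k e n) (hk : 3 ≤ k) (d : Space3) :
    ∃ m x, IsFan (convexHull ℝ V) v d m x := by
  have hk0 : (0 : ℝ) < k - 1 := by
    have : (3 : ℝ) ≤ k := by exact_mod_cast hk
    linarith
  have hkz (i : ℕ) (hi : i < k) (hi0 : 0 < i) : (i : ZMod k) ≠ 0 := by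
    rw [Ne, ZMod.natCast_eq_zero_iff]
    exact fun h => absurd (Nat.le_of_dvd hi0 h) (by omega)
  by_cases hd₁ : ∃ (j : ZMod k) (σ : ℝ), 0 < σ ∧ d = σ • e j
  · -- the ray runs along an edge
    obtain ⟨j, σ, hσ, rfl⟩ := hd₁
    -- The fan starts at the midpoint direction of face `j`, runs around through the other edges and
    -- ends at that of face `j - 1`: two half faces and `k - 2` full ones.
    set x : ℕ → Space3 := fun i => if i = 0 then (1 / 2 : ℝ) • e j + (1 / 2 : ℝ) • e (j + 1) else
      if i = k then (1 / 2 : ℝ) • e j + (1 / 2 : ℝ) • e (j - 1) else e (j + i)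
    have hx0 : x 0 = (1 / 2 : ℝ) • e j + (1 / 2 : ℝ) • e (j + 1) := if_pos rfl
    have hxk : x k = (1 / 2 : ℝ) • e j + (1 / 2 : ℝ) • e (j - 1) := by
      simp [x, show k ≠ 0 by omega]
    have hxi : ∀ i, i ≠ 0 → i ≠ k → x i = e (j + i) := fun i h0 hk => by simp [x, h0, hk]
    have hk1 : ((k - 1 : ℕ) : ZMod k) = -1 := by
      rw [Nat.cast_sub (by omega)]; simp
    refine ⟨k, x, h.isFan hk j (A := fun i => if i = 0 then 1 / 2 else 1)
      (B := fun i => if i = 0 then 1 / 2 else 0) (C := fun i => if i = k - 1 then 1 / 2 else 0)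
      (D := fun i => if i = k - 1 then 1 / 2 else 1) ?_ ?_ ?_ ?_ ?_ ?_⟩
    · intro i hi
      by_cases h0 : i = 0
      · simp [h0, hx0]
      · simp [h0, hxi i h0 hi.ne]
    · intro i hi
      by_cases h0 : i = k - 1
      · have : i + 1 = k := by omega
        rw [this, hxk, h0, hk1]
        simp [← sub_eq_add_neg, add_comm]
      · rw [hxi (i + 1) (by omega) (by omega)]
        simp [h0, add_assoc]
    · intro i
      refine ⟨?_, ?_, ?_, ?_, ?_, ?_⟩ <;> split_ifs <;> norm_num
    · intro i hi
      rw [hxi (i + 1) (by omega) (by omega)]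
      push_cast
      rw [add_assoc]
    · intro i hi s t r hs ht hr h0
      by_cases hi0 : i = 0
      · subst hi0
        have h1 : (0 : ℕ) ≠ k - 1 := by omega
        simp only [if_true, h1, if_false, Nat.cast_zero, add_zero, mul_zero, mul_one] at h0
        obtain ⟨-, h2⟩ := h.indep hk j (a := s * (1 / 2) - r * σ) (b := s * (1 / 2) + t) (by
          rw [← sub_eq_zero] at h0; rw [← h0]; module)
        constructor <;> linarith
      · by_cases hi1 : i = k - 1
        · subst hi1
          have e1 : j + -1 + 1 = j := by ring
          simp only [if_true, hi0, if_false, hk1, mul_zero, mul_one, e1, zero_add] at h0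
          obtain ⟨h2, -⟩ := h.indep hk (j + -1) (a := s + t * (1 / 2))
            (b := t * (1 / 2) - r * σ) (by
              rw [← sub_eq_zero] at h0; rw [e1, ← h0]; module)
          constructor <;> linarith
        · simp only [hi0, hi1, if_false, mul_zero, mul_one, add_zero, zero_add] at h0
          have h1 := congrArg (inner ℝ (n (j + i))) h0
          simp only [inner_add_right, real_inner_smul_right, h.inner_eq, h.inner_eq', mul_zero,
            add_zero] at h1
          have h2 := h.inner_lt (j + i) j (fun h => hkz i hi (by omega) (by linear_combination -h))
            (fun h => hkz (i + 1) (by omega) (by omega) (by push_cast; linear_combination -h))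
          have hr0 : r = 0 := by simpa [hσ.ne', h2.ne] using h1.symm
          subst hr0
          exact h.indep hk (j + i) (by simpa using h0)
    · set α := Real.pi / ((k : ℝ) - 1)
      have hα : 0 ≤ α := by positivity
      -- Half an angle is lost in the first and in the last triangle, so the bounds add up to `k * α
      -- - α = π`.
      have hb : ∀ i ∈ Finset.range k, α - (if i = 0 then α / 2 else 0) -
          (if i = k - 1 then α / 2 else 0) ≤ InnerProductGeometry.angle (x i) (x (i + 1)) := by
        intro i hi
        rw [Finset.mem_range] at hi
        by_cases hi0 : i = 0
        · subst hi0
          have h1 : (0 : ℕ) ≠ k - 1 := by omega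
          rw [hx0, hxi 1 (by omega) (by omega), if_pos rfl, if_neg h1, Nat.cast_one]
          have := half_angle_le (h.norm_eq j)
          have := h.angle j
          linarith
        · by_cases hi1 : i = k - 1
          · have h1 : i + 1 = k := by omega
            have h2 := h.angle (j - 1)
            have h3 := half_angle_le (h.norm_eq (j - 1)).symm
            rw [sub_add_cancel] at h2 h3
            rw [InnerProductGeometry.angle_comm (e j)] at h3
            rw [h1, hxk, hxi i hi0 (by omega), if_neg hi0, if_pos hi1, hi1, hk1,
              ← sub_eq_add_neg, InnerProductGeometry.angle_comm]
            linarith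
          · rw [hxi i hi0 (by omega), hxi (i + 1) (by omega) (by omega), if_neg hi0, if_neg hi1]
            push_cast
            rw [← add_assoc]
            have := h.angle (j + i)
            linarith
      refine le_trans ?_ (Finset.sum_le_sum hb)
      rw [Finset.sum_sub_distrib, Finset.sum_sub_distrib, Finset.sum_ite_eq', Finset.sum_ite_eq',
        if_pos (Finset.mem_range.2 (by omega)), if_pos (Finset.mem_range.2 (by omega))]
      simp only [Finset.sum_const, Finset.card_range, nsmul_eq_mul]
      have : ((k : ℝ) - 1) * α = Real.pi := mul_div_cancel₀ _ hk0.ne'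
      linarith
  · -- the ray runs in the interior of a face, or not on the surface
    have key : ∃ j : ZMod k, ∀ i < k - 1, ∀ S T r : ℝ, 0 ≤ S → 0 ≤ T → 0 ≤ r →
        S • e (j + i) + T • e (j + i + 1) = r • d → S = 0 ∧ T = 0 := by
      by_cases hd₂ : ∃ (p : ZMod k) (σ τ : ℝ), 0 < σ ∧ 0 < τ ∧ d = σ • e p + τ • e (p + 1)
      · obtain ⟨p, σ, τ, hσ, hτ, rfl⟩ := hd₂
        -- Starting at `p + 1`, the `k - 1` faces used are all except face `p`, which contains the
        -- ray.
        refine ⟨p + 1, fun i hi S T r hS hT hr h0 => ?_⟩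
        have := h.sector_disjoint hk (q := p + 1 + i) (p := p) (σ := r * σ) (τ := r * τ)
          (fun h => hkz (i + 1) (by omega) (by omega) (by push_cast; linear_combination h)) hS hT
          (by rw [h0]; module)
        have hr0 : r = 0 := by simpa [hσ.ne', hτ.ne'] using this
        subst hr0
        exact h.indep hk (p + 1 + i) (by simpa using h0)
      · refine ⟨0, fun i hi S T r hS hT hr h0 => ?_⟩
        rcases hr.eq_or_lt with rfl | hr
        · exact h.indep hk _ (by simpa using h0)
        · have hd : d = (S / r) • e (0 + i) + (T / r) • e (0 + i + 1) := by
            rw [div_eq_inv_mul, div_eq_inv_mul, mul_smul, mul_smul, ← smul_add, h0,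
              inv_smul_smul₀ hr.ne']
          by_contra hST
          rcases hS.eq_or_lt with rfl | hS
          · have hT : 0 < T := lt_of_le_of_ne hT fun h => hST ⟨rfl, h.symm⟩
            exact hd₁ ⟨_, T / r, by positivity, by simpa using hd⟩
          · rcases hT.eq_or_lt with rfl | hT
            · exact hd₁ ⟨_, S / r, by positivity, by simpa using hd⟩
            · exact hd₂ ⟨_, S / r, T / r, by positivity, by positivity, hd⟩
    obtain ⟨j, hj⟩ := key
    refine ⟨k - 1, fun i => e (j + i), h.isFan hk j (A := fun _ => 1) (B := fun _ => 0)
      (C := fun _ => 0) (D := fun _ => 1) (by simp) (by simp [add_assoc]) (by simp)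
      (by simp [add_assoc]) ?_ ?_⟩
    · intro i hi s t r hs ht hr h0
      exact hj i hi s t r hs ht hr (by simpa using h0)
    · have : ∀ i ∈ Finset.range (k - 1), Real.pi / ((k : ℝ) - 1) ≤
          InnerProductGeometry.angle (e (j + i)) (e (j + ((i + 1 : ℕ) : ZMod k))) := by
        intro i _
        have := h.angle (j + i)
        push_cast
        rwa [← add_assoc]
      refine le_trans ?_ (Finset.sum_le_sum this)
      rw [Finset.sum_const, Finset.card_range, nsmul_eq_mul, Nat.cast_sub (by omega), Nat.cast_one,
        mul_div_cancel₀ _ hk0.ne']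

/-- Three consecutive edge vectors are independent, because the normal of the face through the first
two is nonzero on the third. So the vertices span space. -/
theorem IsPolyhedralCorner.interior_nonempty (h : IsPolyhedralCorner V v k e n) (hk : 3 ≤ k) :
    (interior (convexHull ℝ V)).Nonempty := by
  obtain ⟨k1, k2⟩ := ZMod.one_ne_zero_two_ne_zero hk
  rw [interior_convexHull_nonempty_iff_affineSpan_eq_top,
    ← AffineSubspace.direction_eq_top_iff_of_nonempty ⟨v, subset_affineSpan ℝ V h.mem⟩]
  have hli : LinearIndependent ℝ ![e 0, e (0 + 1), e (0 + 1 + 1)] := by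
    rw [Fintype.linearIndependent_iff]
    intro g hg
    simp only [Fin.sum_univ_three, Matrix.cons_val_zero, Matrix.cons_val_one,
      Matrix.cons_val] at hg
    have h1 := congrArg (inner ℝ (n 0)) hg
    have h3 := h.inner_lt 0 (0 + 1 + 1) (fun h => k2 (by linear_combination h))
      (fun h => k1 (by linear_combination h))
    have h4 := h.inner_eq' 0
    rw [zero_add] at h4
    simp only [inner_add_right, real_inner_smul_right, h.inner_eq, h4, mul_zero,
      zero_add, inner_zero_right] at h1
    have g2 : g 2 = 0 := (mul_eq_zero.1 h1).resolve_right (by simpa using h3.ne)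
    rw [g2, zero_smul, add_zero] at hg
    obtain ⟨g0, g1⟩ := h.indep hk 0 hg
    intro i
    fin_cases i <;> assumption
  have hspan := hli.span_eq_top_of_card_eq_finrank (by simp)
  rw [eq_top_iff, ← hspan, Submodule.span_le]
  have hmem (i : ZMod k) : e i ∈ (affineSpan ℝ V).direction := by
    have := AffineSubspace.vsub_mem_direction (subset_affineSpan ℝ V (h.mem_e i))
      (subset_affineSpan ℝ V h.mem)
    simpa using this
  rintro _ ⟨i, rfl⟩
  fin_cases i <;> exact hmem _

theorem not_hasConvexUnfolding_of_isPolyhedralCorner (hV : V.Finite) (hne : V.Nonempty)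
    (h : ∀ v ∈ V, ∃ k, 3 ≤ k ∧ ∃ e n : ZMod k → Space3, IsPolyhedralCorner V v k e n) :
    ¬ HasConvexUnfolding (convexHull ℝ V) := by
  refine not_hasConvexUnfolding_of_isFan fun v hv d => ?_
  by_cases hvV : v ∈ V
  · obtain ⟨k, hk, e, n, hc⟩ := h v hvV
    exact hc.exists_isFan hk d
  · obtain ⟨w, hw⟩ := hne
    obtain ⟨k, hk, e, n, hc⟩ := h w hw
    exact exists_isFan_of_notMem hV (hc.interior_nonempty hk) hv hvV d

end

/-! ### The corners of the four other solids. -/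

theorem Space3.inner_eq (x y : Space3) : inner ℝ x y = x 0 * y 0 + x 1 * y 1 + x 2 * y 2 := by
  simp [PiLp.inner_apply, Fin.sum_univ_three, mul_comm]

theorem pi_div_two_le_angle {E : Type*} [NormedAddCommGroup E] [InnerProductSpace ℝ E] {x y : E}
    (h : inner ℝ x y ≤ 0) : Real.pi / 2 ≤ InnerProductGeometry.angle x y := by
  rw [InnerProductGeometry.angle, ← Real.arccos_zero]
  exact Real.arccos_le_arccos (div_nonpos_of_nonpos_of_nonneg h (by positivity))

theorem pi_div_three_le_angle {E : Type*} [NormedAddCommGroup E] [InnerProductSpace ℝ E] {x y : E}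
    (hxy : ‖x‖ = ‖y‖) (h : 2 * inner ℝ x y ≤ inner ℝ x x) :
    Real.pi / 3 ≤ InnerProductGeometry.angle x y := by
  have h1 : Real.arccos (1 / 2) = Real.pi / 3 := by
    rw [← Real.cos_pi_div_three, Real.arccos_cos] <;> linarith [Real.pi_pos]
  rw [InnerProductGeometry.angle, ← h1]
  refine Real.arccos_le_arccos (div_le_of_le_mul₀ (by positivity) (by norm_num) ?_)
  rw [← hxy]
  rw [real_inner_self_eq_norm_mul_norm] at h
  linarith

theorem norm_eq_of_inner_self_eq {E : Type*} [NormedAddCommGroup E] [InnerProductSpace ℝ E]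
    {x y : E} (h : inner ℝ x x = inner ℝ y y) : ‖x‖ = ‖y‖ := by
  rw [real_inner_self_eq_norm_sq, real_inner_self_eq_norm_sq] at h
  exact (sq_eq_sq₀ (norm_nonneg _) (norm_nonneg _)).1 h

/-- The vertex `v` of a polytope with vertex set `V` has a corner. -/
def HasCorner (V : Set Space3) (v : Space3) : Prop :=
  ∃ k, 3 ≤ k ∧ ∃ e n : ZMod k → Space3, IsPolyhedralCorner V v k e n

/-- By symmetry, corners need to be exhibited only at one vertex in each orbit. -/
theorem HasCorner.of_map {V : Set Space3} {v : Space3} (M : Space3 ≃ₗᵢ[ℝ] Space3)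
    (hM : ∀ x, M x ∈ V ↔ x ∈ V) (h : HasCorner V (M v)) : HasCorner V v := by
  obtain ⟨k, hk, e, n, hc⟩ := h
  have hin (x y : Space3) : inner ℝ (M.symm x) y = inner ℝ x (M y) := by
    rw [← M.inner_map_map, M.apply_symm_apply]
  refine ⟨k, hk, fun i => M.symm (e i), fun i => M.symm (n i), (hM v).1 hc.mem, ?_, ?_, ?_, ?_, ?_,
    ?_, ?_⟩
  · intro i
    rw [← hM, map_add, M.apply_symm_apply]
    exact hc.mem_e i
  · intro i w hw
    rw [hin, hin]
    exact hc.le i _ ((hM w).2 hw)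
  · intro i
    rw [M.symm.inner_map_map, hc.inner_eq]
  · intro i
    rw [M.symm.inner_map_map, hc.inner_eq']
  · intro i j h1 h2
    rw [M.symm.inner_map_map]
    exact hc.inner_lt i j h1 h2
  · intro i
    simpa using hc.norm_eq i
  · intro i
    have := M.symm.toLinearIsometry.angle_map (e i) (e (i + 1))
    exact (hc.angle i).trans this.ge

/-- The cyclic permutation of the coordinates. -/
noncomputable def rotateCoords : Space3 ≃ₗᵢ[ℝ] Space3 :=
  LinearIsometryEquiv.piLpCongrLeft 2 ℝ ℝ (Equiv.addRight (-1 : Fin 3))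

theorem rotateCoords_apply (x : Space3) (i : Fin 3) : rotateCoords x i = x (i + 1) := by
  simp [rotateCoords, LinearIsometryEquiv.piLpCongrLeft_apply, Equiv.piCongrLeft']

/-- Here `k` is the number of faces minus one. `ZMod (k + 1)` unfolds to `Fin (k + 1)`, so concrete
corners can be checked entry by entry. -/
theorem HasCorner.of_fin {V : Set Space3} {v : Space3} {k : ℕ} (hk : 2 ≤ k)
    (e n : Fin (k + 1) → Space3) (mem : v ∈ V) (mem_e : ∀ i, v + e i ∈ V)
    (le : ∀ i, ∀ w ∈ V, inner ℝ (n i) w ≤ inner ℝ (n i) v)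
    (inner_eq : ∀ i, inner ℝ (n i) (e i) = 0 ∧ inner ℝ (n i) (e (i + 1)) = 0)
    (inner_lt : ∀ i j, j ≠ i → j ≠ i + 1 → inner ℝ (n i) (e j) < 0)
    (inner_self_eq : ∀ i, inner ℝ (e i) (e i) = inner ℝ (e (i + 1)) (e (i + 1)))
    (angle : ∀ i, Real.pi / k ≤ InnerProductGeometry.angle (e i) (e (i + 1))) :
    HasCorner V v :=
  ⟨k + 1, by omega, e, n, mem, mem_e, le, fun i => (inner_eq i).1, fun i => (inner_eq i).2,
    inner_lt, fun i => norm_eq_of_inner_self_eq (inner_self_eq i), fun i => by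
      have := angle i
      push_cast
      rwa [add_sub_cancel_right]⟩

/-- Three right angles meet at the vertex; two of them make exactly π. -/
theorem hasCorner_cube : HasCorner (PlatonicSolid.cube.vertices) !₂[1, 1, 1] := by
  refine HasCorner.of_fin le_rfl ![!₂[-2, 0, 0], !₂[0, -2, 0], !₂[0, 0, -2]]
    ![!₂[0, 0, 1], !₂[1, 0, 0], !₂[0, 1, 0]] ?_ ?_ ?_ ?_ ?_ ?_ ?_
  · simp [PlatonicSolid.vertices, Fin.forall_fin_succ]
  · simp [PlatonicSolid.vertices, Fin.forall_fin_succ]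
    norm_num
  · intro i w hw
    have h (j : Fin 3) := (abs_le.1 (hw j).le).2
    fin_cases i <;> simp [Space3.inner_eq, h]
  · intro i; fin_cases i <;> simp [Space3.inner_eq]
  · intro i j; fin_cases i <;> fin_cases j <;> simp [Space3.inner_eq]
  · intro i; simp only [Space3.inner_eq]; fin_cases i <;> simp
  · intro i
    refine pi_div_two_le_angle ?_
    fin_cases i <;> simp [Space3.inner_eq]

/-- Four equilateral triangles meet at the vertex; three of their angles make exactly π. -/
theorem hasCorner_octahedron : HasCorner (PlatonicSolid.octahedron.vertices) !₂[1, 0, 0] := by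
  refine HasCorner.of_fin (k := 3) (by norm_num)
    ![!₂[-1, 1, 0], !₂[-1, 0, 1], !₂[-1, -1, 0], !₂[-1, 0, -1]]
    ![!₂[1, 1, 1], !₂[1, -1, 1], !₂[1, -1, -1], !₂[1, 1, -1]] ?_ ?_ ?_ ?_ ?_ ?_ ?_
  · exact ⟨0, by simp⟩
  · intro i
    fin_cases i
    exacts [⟨1, by simp⟩, ⟨2, by simp⟩, ⟨1, by simp⟩, ⟨2, by simp⟩]
  · rintro i w ⟨j, h1, h2, h3⟩
    have := abs_le.1 h1.le
    fin_cases j <;> fin_cases i <;> simp [Space3.inner_eq] at * <;> linarith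
  · intro i; fin_cases i <;> simp [Space3.inner_eq]
  · intro i j; fin_cases i <;> fin_cases j <;> simp [Space3.inner_eq]
  · intro i; simp only [Space3.inner_eq]; fin_cases i <;> simp
  · intro i
    refine pi_div_three_le_angle (norm_eq_of_inner_self_eq ?_) ?_ <;>
    simp only [Space3.inner_eq] <;> fin_cases i <;> simp <;> norm_num

section Golden

variable {g : ℝ}

/-- The vertices of the icosahedron, in terms of the golden ratio `g`. -/
def icosahedronVertices (g : ℝ) : Set Space3 := {v | ∃ i, v i = 0 ∧ |v (i + 1)| = 1 ∧ |v (i + 2)| = g}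

/-- The vertices of the dodecahedron, in terms of the golden ratio `g`. -/
def dodecahedronVertices (g : ℝ) : Set Space3 :=
  {v | ∀ i, |v i| = 1} ∪ {v | ∃ i, v i = 0 ∧ |v (i + 1)| = g ∧ |v (i + 2)| = g - 1}

theorem hasCorner_icosahedron (h1 : 1 < g) (h2 : g ^ 2 = g + 1) :
    HasCorner (icosahedronVertices g) !₂[0, 1, g] := by
  have h0 : 0 < g := one_pos.trans h1
  have h3 : g < 2 := by nlinarith
  refine HasCorner.of_fin (k := 4) (by norm_num)
    ![!₂[0, -2, 0], !₂[g, -1, 1 - g], !₂[1, g - 1, -g], !₂[-1, g - 1, -g], !₂[-g, -1, 1 - g]]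
    ![!₂[1, 0, g + 1], !₂[1, 1, 1], !₂[0, g + 1, 1], !₂[-1, 1, 1], !₂[-1, 0, g + 1]]
    ?_ ?_ ?_ ?_ ?_ ?_ ?_
  · exact ⟨0, by simp [abs_of_pos h0]⟩
  · intro i
    fin_cases i
    · exact ⟨0, by simp [abs_of_pos h0]; norm_num⟩
    · exact ⟨1, by simp [abs_of_pos h0]⟩
    · exact ⟨2, by simp [abs_of_pos h0]⟩
    · exact ⟨2, by simp [abs_of_pos h0]⟩
    · exact ⟨1, by simp [abs_of_pos h0]⟩
  · rintro i w ⟨j, h3, h4, h5⟩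
    rcases eq_or_eq_neg_of_abs_eq h4 with h4 | h4 <;>
    rcases eq_or_eq_neg_of_abs_eq h5 with h5 | h5 <;>
    fin_cases j <;> simp at h3 h4 h5 <;> fin_cases i <;>
    simp [Space3.inner_eq, h3, h4, h5] <;> nlinarith
  · intro i; fin_cases i <;> simp [Space3.inner_eq] <;> nlinarith
  · intro i j; fin_cases i <;> fin_cases j <;> simp [Space3.inner_eq] <;> nlinarith
  · intro i; simp only [Space3.inner_eq]; fin_cases i <;> simp <;> nlinarith
  · intro i
    -- Only π/4 is required, and the faces are equilateral with angle π/3.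
    refine le_trans (div_le_div_of_nonneg_left Real.pi_pos.le (by norm_num) (by norm_num))
      (pi_div_three_le_angle (norm_eq_of_inner_self_eq ?_) ?_) <;>
    simp only [Space3.inner_eq] <;> fin_cases i <;> simp <;> nlinarith

/-- Two pentagon angles exceed π; it is enough that each is not acute. Sign changes and cyclic
rotations do not mix the cube vertices with the others, so both kinds need a corner. -/
theorem hasCorner_dodecahedron (h1 : 1 < g) (h2 : g ^ 2 = g + 1) :
    HasCorner (dodecahedronVertices g) !₂[1, 1, 1] := by
  have h0 : 0 < g := one_pos.trans h1
  have h0' : 0 < g - 1 := by linarith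
  have h3 : g < 2 := by nlinarith
  refine HasCorner.of_fin le_rfl
    ![!₂[-1, g - 1, g - 2], !₂[g - 2, -1, g - 1], !₂[g - 1, g - 2, -1]]
    ![!₂[0, 1, g], !₂[g, 0, 1], !₂[1, g, 0]]
    ?_ ?_ ?_ ?_ ?_ ?_ ?_
  · exact Or.inl (by simp [Fin.forall_fin_succ])
  · have e : 1 + (g - 2) = g - 1 := by ring
    intro i
    fin_cases i
    · exact Or.inr ⟨0, by simp [abs_of_pos h0, e, abs_of_pos h0']⟩
    · exact Or.inr ⟨1, by simp [abs_of_pos h0, e, abs_of_pos h0']⟩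
    · exact Or.inr ⟨2, by simp [abs_of_pos h0, e, abs_of_pos h0']⟩
  · rintro i w (hw | ⟨j, h3, h4, h5⟩)
    · rcases eq_or_eq_neg_of_abs_eq (hw 0) with h3 | h3 <;>
      rcases eq_or_eq_neg_of_abs_eq (hw 1) with h4 | h4 <;>
      rcases eq_or_eq_neg_of_abs_eq (hw 2) with h5 | h5 <;>
      fin_cases i <;> simp [Space3.inner_eq, h3, h4, h5] <;> nlinarith
    · rcases eq_or_eq_neg_of_abs_eq h4 with h4 | h4 <;>
      rcases eq_or_eq_neg_of_abs_eq h5 with h5 | h5 <;>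
      fin_cases j <;> simp at h3 h4 h5 <;> fin_cases i <;>
      simp [Space3.inner_eq, h3, h4, h5] <;> nlinarith
  · intro i; fin_cases i <;> simp [Space3.inner_eq] <;> constructor <;> linarith
  · intro i j; fin_cases i <;> fin_cases j <;> simp [Space3.inner_eq]
  · intro i; simp only [Space3.inner_eq]; fin_cases i <;> simp <;> nlinarith
  · intro i
    refine pi_div_two_le_angle ?_
    simp only [Space3.inner_eq]; fin_cases i <;> simp <;> nlinarith

theorem hasCorner_dodecahedron' (h1 : 1 < g) (h2 : g ^ 2 = g + 1) :
    HasCorner (dodecahedronVertices g) !₂[0, g, g - 1] := by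
  have h0 : 0 < g := one_pos.trans h1
  have h0' : 0 < g - 1 := by linarith
  have h3 : g < 2 := by nlinarith
  refine HasCorner.of_fin le_rfl
    ![!₂[0, 0, 2 - 2 * g], !₂[1, 1 - g, 2 - g], !₂[-1, 1 - g, 2 - g]]
    ![!₂[1, g, 0], !₂[0, 1, g], !₂[-1, g, 0]]
    ?_ ?_ ?_ ?_ ?_ ?_ ?_
  · exact Or.inr ⟨0, by simp [abs_of_pos h0, abs_of_pos h0']⟩
  · have e : g - 1 + (2 - 2 * g) = -(g - 1) := by ring
    have e' : g - 1 + (2 - g) = 1 := by ring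
    intro i
    fin_cases i
    · exact Or.inr ⟨0, by simp [abs_of_pos h0, e, abs_of_pos h0', abs_sub_comm]⟩
    · exact Or.inl (by simp [Fin.forall_fin_succ, e'])
    · exact Or.inl (by simp [Fin.forall_fin_succ, e'])
  · rintro i w (hw | ⟨j, h3, h4, h5⟩)
    · rcases eq_or_eq_neg_of_abs_eq (hw 0) with h3 | h3 <;>
      rcases eq_or_eq_neg_of_abs_eq (hw 1) with h4 | h4 <;>
      rcases eq_or_eq_neg_of_abs_eq (hw 2) with h5 | h5 <;>
      fin_cases i <;> simp [Space3.inner_eq, h3, h4, h5] <;> nlinarith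
    · rcases eq_or_eq_neg_of_abs_eq h4 with h4 | h4 <;>
      rcases eq_or_eq_neg_of_abs_eq h5 with h5 | h5 <;>
      fin_cases j <;> simp at h3 h4 h5 <;> fin_cases i <;>
      simp [Space3.inner_eq, h3, h4, h5] <;> nlinarith
  · intro i; fin_cases i <;> simp [Space3.inner_eq] <;> nlinarith
  · intro i j; fin_cases i <;> fin_cases j <;> simp [Space3.inner_eq] <;> nlinarith
  · intro i; simp only [Space3.inner_eq]; fin_cases i <;> simp <;> nlinarith
  · intro i
    refine pi_div_two_le_angle ?_
    simp only [Space3.inner_eq]; fin_cases i <;> simp <;> nlinarith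

end Golden

/-- Reflecting the negative coordinates moves the vertex into the nonnegative octant. -/
theorem HasCorner.of_abs {V : Set Space3} (hV : ∀ x y : Space3, (∀ i, |x i| = |y i|) → x ∈ V → y ∈ V)
    {v : Space3} (h : HasCorner V !₂[|v 0|, |v 1|, |v 2|]) : HasCorner V v := by
  classical
  set M : Space3 ≃ₗᵢ[ℝ] Space3 := LinearIsometryEquiv.piLpCongrRight 2
    fun i => if v i < 0 then LinearIsometryEquiv.neg ℝ else LinearIsometryEquiv.refl ℝ ℝ
  have hM (x : Space3) (i : Fin 3) : M x i = if v i < 0 then -x i else x i := by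
    simp only [M, LinearIsometryEquiv.piLpCongrRight_apply]
    split_ifs <;> simp
  have habs (x : Space3) (i : Fin 3) : |M x i| = |x i| := by
    rw [hM]; split_ifs <;> simp
  refine HasCorner.of_map M (fun x => ⟨hV _ _ (habs x), hV _ _ fun i => (habs x i).symm⟩) ?_
  convert h using 1
  have hv (i : Fin 3) : M v i = |v i| := by
    rw [hM]
    split_ifs with h
    · rw [abs_of_neg h]
    · rw [abs_of_nonneg (not_lt.1 h)]
  ext i
  fin_cases i <;> simp [hv]

theorem HasCorner.of_rotate {V : Set Space3}
    (hV : ∀ x y : Space3, (∀ i, x i = y (i + 1)) → (x ∈ V ↔ y ∈ V)) {a b c : ℝ}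
    (h : HasCorner V !₂[a, b, c]) : HasCorner V !₂[c, a, b] := by
  refine HasCorner.of_map rotateCoords (fun x => hV _ _ (rotateCoords_apply x)) ?_
  convert h using 1
  ext i
  rw [rotateCoords_apply]
  fin_cases i <;> rfl

theorem finite_setOf_forall_mem {S : Set ℝ} (hS : S.Finite) : {v : Space3 | ∀ i, v i ∈ S}.Finite := by
  have h1 : (Set.univ.pi fun _ : Fin 3 => S).Finite := Set.Finite.pi fun _ => hS
  refine (h1.preimage (f := fun v : Space3 => v.ofLp) (WithLp.ofLp_injective 2).injOn).subset ?_
  intro v hv i _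
  exact hv i

theorem not_hasConvexUnfolding_cube : ¬ HasConvexUnfolding (convexHull ℝ PlatonicSolid.cube.vertices) := by
  refine not_hasConvexUnfolding_of_isPolyhedralCorner ?_ ⟨!₂[1, 1, 1], ?_⟩ ?_
  · refine (finite_setOf_forall_mem (S := {1, -1}) (by simp)).subset fun v hv i => ?_
    simpa using eq_or_eq_neg_of_abs_eq (hv i)
  · simp [PlatonicSolid.vertices, Fin.forall_fin_succ]
  · intro v hv
    refine HasCorner.of_abs (fun x y h (hx : ∀ i, |x i| = 1) i => by rw [← h i, hx i]) ?_
    rw [hv 0, hv 1, hv 2]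
    exact hasCorner_cube

theorem not_hasConvexUnfolding_octahedron :
    ¬ HasConvexUnfolding (convexHull ℝ PlatonicSolid.octahedron.vertices) := by
  have hrot : ∀ x y : Space3, (∀ i, x i = y (i + 1)) →
      (x ∈ PlatonicSolid.octahedron.vertices ↔ y ∈ PlatonicSolid.octahedron.vertices) := by
    intro x y h
    simp [PlatonicSolid.vertices, Fin.exists_fin_succ, h]
    tauto
  refine not_hasConvexUnfolding_of_isPolyhedralCorner ?_ ⟨!₂[1, 0, 0], ⟨0, by simp⟩⟩ ?_
  · refine (finite_setOf_forall_mem (S := {0, 1, -1}) (by simp)).subset ?_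
    rintro v ⟨j, h1, h2, h3⟩ i
    have h1 := eq_or_eq_neg_of_abs_eq h1
    fin_cases j <;> fin_cases i <;> simp at * <;> simp [*]
  · rintro v ⟨j, h1, h2, h3⟩
    refine HasCorner.of_abs ?_ ?_
    · rintro x y h ⟨i, h1, h2, h3⟩
      exact ⟨i, by rw [← h, h1], by rw [← abs_eq_zero, ← h, h2, abs_zero],
        by rw [← abs_eq_zero, ← h, h3, abs_zero]⟩
    · fin_cases j <;> simp at h1 h2 h3 <;> simp only [h1, h2, h3, abs_zero]
      · exact hasCorner_octahedron
      · exact hasCorner_octahedron.of_rotate hrot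
      · exact (hasCorner_octahedron.of_rotate hrot).of_rotate hrot

section Golden

variable {g : ℝ}

theorem not_hasConvexUnfolding_icosahedron (h1 : 1 < g) (h2 : g ^ 2 = g + 1) :
    ¬ HasConvexUnfolding (convexHull ℝ (icosahedronVertices g)) := by
  have hrot : ∀ x y : Space3, (∀ i, x i = y (i + 1)) →
      (x ∈ icosahedronVertices g ↔ y ∈ icosahedronVertices g) := by
    intro x y h
    simp [icosahedronVertices, Fin.exists_fin_succ, h]
    tauto
  have hc := hasCorner_icosahedron h1 h2
  refine not_hasConvexUnfolding_of_isPolyhedralCorner ?_ ⟨!₂[0, 1, g], ⟨0, ?_⟩⟩ ?_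
  · refine (finite_setOf_forall_mem (S := {0, 1, -1, g, -g}) (by simp)).subset ?_
    rintro v ⟨j, h1, h2, h3⟩ i
    have h2 := eq_or_eq_neg_of_abs_eq h2
    have h3 := eq_or_eq_neg_of_abs_eq h3
    simp only [Set.mem_insert_iff, Set.mem_singleton_iff]
    fin_cases j <;> fin_cases i <;> simp at h1 h2 h3 <;> simp <;> tauto
  · simpa using (one_pos.trans h1).le
  · rintro v ⟨j, h1, h2, h3⟩
    refine HasCorner.of_abs ?_ ?_
    · rintro x y h ⟨i, h1, h2, h3⟩
      exact ⟨i, by rw [← abs_eq_zero, ← h, h1, abs_zero], by rw [← h, h2], by rw [← h, h3]⟩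
    · fin_cases j <;> simp at h1 h2 h3 <;> simp only [h1, h2, h3, abs_zero]
      · exact hc
      · exact hc.of_rotate hrot
      · exact (hc.of_rotate hrot).of_rotate hrot

theorem not_hasConvexUnfolding_dodecahedron (h1 : 1 < g) (h2 : g ^ 2 = g + 1) :
    ¬ HasConvexUnfolding (convexHull ℝ (dodecahedronVertices g)) := by
  have hrot : ∀ x y : Space3, (∀ i, x i = y (i + 1)) →
      (x ∈ dodecahedronVertices g ↔ y ∈ dodecahedronVertices g) := by
    intro x y h
    simp [dodecahedronVertices, Fin.exists_fin_succ, Fin.forall_fin_succ, h]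
    tauto
  have hc := hasCorner_dodecahedron' h1 h2
  refine not_hasConvexUnfolding_of_isPolyhedralCorner ?_
    ⟨!₂[1, 1, 1], Or.inl (by simp [Fin.forall_fin_succ])⟩ ?_
  · refine (finite_setOf_forall_mem (S := {0, 1, -1, g, -g, g - 1, -(g - 1)}) (by simp)).subset ?_
    rintro v (hv | ⟨j, h1, h2, h3⟩) i
    · have := eq_or_eq_neg_of_abs_eq (hv i)
      simp only [Set.mem_insert_iff, Set.mem_singleton_iff]
      tauto
    · have h2 := eq_or_eq_neg_of_abs_eq h2
      have h3 := eq_or_eq_neg_of_abs_eq h3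
      simp only [Set.mem_insert_iff, Set.mem_singleton_iff]
      fin_cases j <;> fin_cases i <;> simp at h1 h2 h3 <;> simp <;> tauto
  · intro v hv
    refine HasCorner.of_abs ?_ ?_
    · rintro x y h (hx | ⟨i, h1, h2, h3⟩)
      · exact Or.inl fun i => by rw [← h, hx i]
      · exact Or.inr ⟨i, by rw [← abs_eq_zero, ← h, h1, abs_zero], by rw [← h, h2],
          by rw [← h, h3]⟩
    · rcases hv with hv | ⟨j, h3, h4, h5⟩
      · rw [hv 0, hv 1, hv 2]
        exact hasCorner_dodecahedron h1 h2
      · fin_cases j <;> simp at h3 h4 h5 <;> simp only [h3, h4, h5, abs_zero]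
        · exact hc
        · exact hc.of_rotate hrot
        · exact (hc.of_rotate hrot).of_rotate hrot

end Golden

theorem not_hasConvexUnfolding_convexHull {s : PlatonicSolid} (hs : s ≠ .tetrahedron) :
    ¬ HasConvexUnfolding (convexHull ℝ s.vertices) := by
  have h1 := Real.one_lt_goldenRatio
  have h2 := Real.goldenRatio_sq
  have h3 : Real.goldenRatio⁻¹ = Real.goldenRatio - 1 := by
    exact inv_eq_of_mul_eq_one_right (by linear_combination h2)
  cases s with
  | tetrahedron => exact absurd rfl hs
  | cube => exact not_hasConvexUnfolding_cube
  | octahedron => exact not_hasConvexUnfolding_octahedron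
  | dodecahedron =>
    have := not_hasConvexUnfolding_dodecahedron h1 h2
    simpa only [PlatonicSolid.vertices, dodecahedronVertices, h3] using this
  | icosahedron => exact not_hasConvexUnfolding_icosahedron h1 h2

/-! ### Invariance under similarities. -/

section Similarity

open scoped Pointwise

variable {Q T : Set Space3} {P : Set Plane2}

theorem IsGeometricTree.image (F : Space3 ≃ᵃ[ℝ] Space3) (h : IsGeometricTree T) :
    IsGeometricTree (F '' T) := by
  obtain ⟨n, G, p, hG, hp, hcross, rfl⟩ := h
  have hseg (a b : Space3) : segment ℝ (F a) (F b) = F '' segment ℝ a b :=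
    (image_segment ℝ F.toAffineMap a b).symm
  refine ⟨n, G, fun i => F (p i), hG, F.injective.comp hp, ?_, ?_⟩
  · intro i j k l hij hkl hne
    rw [hseg, hseg, ← Set.image_inter F.injective]
    refine (Set.image_mono (hcross i j k l hij hkl hne)).trans ?_
    rw [Set.image_inter F.injective, Set.image_pair, Set.image_pair]
  · simp only [hseg, Set.image_union, Set.image_iUnion, ← Set.range_comp]
    rfl

/-- The flattening is conjugated by the similarity of space and by scaling of the plane; the two
factors `c` cancel. -/
theorem FlattensOnto.image (F : Space3 ≃ᵃ[ℝ] Space3) {c : ℝ} (hc : 0 < c)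
    (hF : ∀ x y, dist (F x) (F y) = c * dist x y) (h : FlattensOnto Q T P) :
    FlattensOnto (F '' Q) (F '' T) (c • P) := by
  obtain ⟨φ, hφ⟩ := h
  set Fh : Space3 ≃ₜ Space3 := F.toContinuousAffineEquiv.toHomeomorph
  have hFh (x : Space3) : Fh x = F x := rfl
  have e1 : Fh '' (frontier Q \ T) = frontier (F '' Q) \ F '' T := by
    rw [Set.image_sdiff Fh.injective, Fh.image_frontier]; rfl
  have e2 : (Homeomorph.smulOfNeZero c hc.ne' : Plane2 ≃ₜ Plane2) '' interior P =
      interior (c • P) := by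
    rw [interior_smul₀ hc.ne']; rfl
  obtain ⟨A, hA⟩ : ∃ A : ↥(frontier Q \ T) ≃ₜ ↥(frontier (F '' Q) \ F '' T),
      ∀ y, (A y : Space3) = F y :=
    ⟨(Fh.image _).trans (Homeomorph.setCongr e1), fun _ => rfl⟩
  obtain ⟨B, hB⟩ : ∃ B : ↥(interior P) ≃ₜ ↥(interior (c • P)),
      ∀ p, (B p : Plane2) = c • (p : Plane2) :=
    ⟨((Homeomorph.smulOfNeZero c hc.ne').image _).trans (Homeomorph.setCongr e2), fun _ => rfl⟩
  refine ⟨(A.symm.trans φ).trans B, fun y z hyz => ?_⟩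
  obtain ⟨y, rfl⟩ := A.surjective y
  obtain ⟨z, rfl⟩ := A.surjective z
  rw [hA, hA, ← e1] at hyz
  have hs : segment ℝ (y : Space3) z ⊆ frontier Q \ T := by
    rw [← Set.image_subset_image_iff Fh.injective]
    refine Eq.trans_subset ?_ hyz
    exact image_segment ℝ F.toAffineMap _ _
  rw [Subtype.dist_eq (A y), hA, hA, hF, ← Subtype.dist_eq, ← hφ y z hs]
  simp only [Homeomorph.trans_apply, Homeomorph.symm_apply_apply, Subtype.dist_eq, hB]
  rw [dist_smul₀, Real.norm_of_nonneg hc.le]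

theorem HasConvexUnfolding.image (F : Space3 ≃ᵃ[ℝ] Space3) {c : ℝ} (hc : 0 < c)
    (hF : ∀ x y, dist (F x) (F y) = c * dist x y) (h : HasConvexUnfolding Q) :
    HasConvexUnfolding (F '' Q) := by
  obtain ⟨P, ⟨⟨V, hV, rfl⟩, hP⟩, T, hT, hTQ, hflat⟩ := h
  refine ⟨c • convexHull ℝ V, ⟨⟨c • V, hV.smul_set, (convexHull_smul c V).symm⟩, ?_⟩, F '' T,
    hT.image F, ?_, hflat.image F hc hF⟩
  · rw [interior_smul₀ hc.ne']
    exact hP.smul_set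
  · have := F.toContinuousAffineEquiv.toHomeomorph.image_frontier Q
    exact (Set.image_mono hTQ).trans this.subset

theorem IsPlatonic.hasConvexUnfolding_iff {s : PlatonicSolid} (hQ : IsPlatonic s Q) :
    HasConvexUnfolding Q ↔ HasConvexUnfolding (convexHull ℝ s.vertices) := by
  obtain ⟨c, e, hc, rfl⟩ := hQ
  set F : Space3 ≃ᵃ[ℝ] Space3 :=
    (LinearEquiv.smulOfNeZero ℝ Space3 c hc.ne').toAffineEquiv.trans e.toAffineEquiv
  have hFx (x : Space3) : F x = e (c • x) := rfl
  have hF (x y : Space3) : dist (F x) (F y) = c * dist x y := by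
    rw [hFx, hFx, e.dist_map, dist_smul₀, Real.norm_of_nonneg hc.le]
  have hF' (x y : Space3) : dist (F.symm x) (F.symm y) = c⁻¹ * dist x y := by
    have := hF (F.symm x) (F.symm y)
    rw [F.apply_symm_apply, F.apply_symm_apply] at this
    rw [this, inv_mul_cancel_left₀ hc.ne']
  change HasConvexUnfolding (F '' _) ↔ _
  refine ⟨fun h => ?_, fun h => h.image F hc hF⟩
  have := h.image F.symm (inv_pos.2 hc) hF'
  rwa [Set.image_image, funext F.symm_apply_apply, Set.image_id'] at this

end Similarity

/-! ### The regular tetrahedron in barycentric coordinates and its cut tree. -/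

/-- A function with unit slope along `w` would exceed its bound just beyond an interior point where
the bound is attained. -/
theorem lt_of_mem_interior {E : Type*} [NormedAddCommGroup E] [NormedSpace ℝ E] {Q : Set E} {x : E}
    (hx : x ∈ interior Q) {f : E → ℝ} {w : E} (hf : ∀ t : ℝ, f (x + t • w) = f x + t) {c : ℝ}
    (hQ : ∀ y ∈ Q, f y ≤ c) : f x < c := by
  have h : ∀ᶠ t : ℝ in nhds 0, x + t • w ∈ Q := by
    have hc : ContinuousAt (fun t : ℝ => x + t • w) 0 := by fun_prop
    exact hc (by simpa using mem_interior_iff_mem_nhds.1 hx)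
  obtain ⟨ε, hε, h⟩ := Metric.eventually_nhds_iff.1 h
  have := hQ _ (h (y := ε / 2) (by
    rw [dist_zero_right, Real.norm_of_nonneg (by linarith)]; linarith))
  rw [hf] at this
  linarith

namespace Tetrahedron

/-- The barycentric coordinates with respect to the vertices of the regular tetrahedron. -/
noncomputable def bary (x : Space3) : Fin 4 → ℝ :=
  ![(1 + x 0 + x 1 + x 2) / 4, (1 + x 0 - x 1 - x 2) / 4, (1 - x 0 + x 1 - x 2) / 4,
    (1 - x 0 - x 1 + x 2) / 4]

/-- The vertices of the regular tetrahedron. -/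
noncomputable def vertex : Fin 4 → Space3 :=
  ![!₂[1, 1, 1], !₂[1, -1, -1], !₂[-1, 1, -1], !₂[-1, -1, 1]]

theorem range_vertex : Set.range vertex = PlatonicSolid.tetrahedron.vertices := by
  ext x
  simp only [vertex, PlatonicSolid.vertices, Matrix.range_cons, Matrix.range_empty, Set.mem_union,
    Set.mem_singleton_iff, Set.mem_insert_iff, Set.mem_empty_iff_false, or_false]

theorem sum_bary (x : Space3) : ∑ i, bary x i = 1 := by
  simp [Fin.sum_univ_four, bary]; ring

theorem sum_bary_smul (x : Space3) : ∑ i, bary x i • vertex i = x := by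
  ext j
  fin_cases j <;> simp [Fin.sum_univ_four, bary, vertex] <;> ring

theorem bary_add_smul (x y : Space3) (s t : ℝ) (hst : s + t = 1) (i : Fin 4) :
    bary (s • x + t • y) i = s * bary x i + t * bary y i := by
  obtain rfl : t = 1 - s := by linarith
  fin_cases i <;> simp [bary] <;> ring

theorem bary_vertex (i j : Fin 4) : bary (vertex i) j = if i = j then 1 else 0 := by
  fin_cases i <;> fin_cases j <;> simp [bary, vertex] <;> norm_num

theorem continuous_bary (i : Fin 4) : Continuous fun x => bary x i := by
  fin_cases i <;> simp only [bary] <;> simp <;> fun_prop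

/-- The regular tetrahedron. -/
def solid : Set Space3 := convexHull ℝ PlatonicSolid.tetrahedron.vertices

theorem mem_solid {x : Space3} : x ∈ solid ↔ ∀ i, 0 ≤ bary x i := by
  constructor
  · intro hx i
    refine convexHull_min (t := {x | 0 ≤ bary x i}) ?_ ?_ hx
    · rw [← range_vertex]
      rintro _ ⟨j, rfl⟩
      rw [Set.mem_ofPred_eq, bary_vertex]
      split_ifs <;> norm_num
    · intro y hy z hz s t hs ht hst
      rw [Set.mem_ofPred_eq] at *
      rw [bary_add_smul _ _ _ _ hst]
      positivity
  · intro h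
    rw [← sum_bary_smul x]
    refine (convex_convexHull ℝ _).sum_mem (fun i _ => h i) (sum_bary x) fun i _ => ?_
    rw [← range_vertex]
    exact subset_convexHull ℝ _ ⟨i, rfl⟩

theorem mem_frontier_solid {x : Space3} :
    x ∈ frontier solid ↔ (∀ i, 0 ≤ bary x i) ∧ ∃ i, bary x i = 0 := by
  have hcl : IsClosed solid := by
    have : solid = ⋂ i, {x | 0 ≤ bary x i} := by ext; simp [mem_solid]
    rw [this]
    exact isClosed_iInter fun i => isClosed_le continuous_const (continuous_bary i)
  have hint : x ∈ interior solid ↔ ∀ i, 0 < bary x i := by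
    constructor
    · intro hx i
      have key (w : Space3) (hw : ∀ t : ℝ, -bary (x + t • w) i = -bary x i + t) :=
        lt_of_mem_interior hx (f := fun x => -bary x i) hw (c := 0)
          fun y hy => by simpa using mem_solid.1 hy i
      rw [← neg_lt_zero]
      -- The coefficient of `x 0` in each barycentric coordinate is ±1/4, so a step of ∓4 along the
      -- first axis lowers it at unit rate.
      fin_cases i
      · exact key !₂[-4, 0, 0] fun t => by simp [bary]; ring
      · exact key !₂[-4, 0, 0] fun t => by simp [bary]; ring
      · exact key !₂[4, 0, 0] fun t => by simp [bary]; ring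
      · exact key !₂[4, 0, 0] fun t => by simp [bary]; ring
    · intro h
      have : IsOpen (⋂ i, {x | 0 < bary x i}) :=
        isOpen_iInter_of_finite fun i => isOpen_lt continuous_const (continuous_bary i)
      refine interior_maximal (fun y hy => mem_solid.2 fun i => ?_) this (by simpa using h)
      exact (Set.mem_iInter.1 hy i).le
  rw [hcl.frontier_eq, Set.mem_sdiff, hint, mem_solid]
  constructor
  · rintro ⟨h1, h2⟩
    push Not at h2
    obtain ⟨i, hi⟩ := h2
    exact ⟨h1, i, le_antisymm hi (h1 i)⟩
  · rintro ⟨h1, i, hi⟩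
    exact ⟨h1, fun h => (h i).ne' hi⟩

/-- The cut tree: the three edges at one vertex. -/
def cut : Set Space3 := {x | ∃ i : Fin 4, i ≠ 0 ∧ x ∈ segment ℝ (vertex 0) (vertex i)}

theorem mem_segment_vertex {x : Space3} {i : Fin 4} (hi : i ≠ 0) :
    x ∈ segment ℝ (vertex 0) (vertex i) ↔
      (∀ j, 0 ≤ bary x j) ∧ ∀ j, j ≠ 0 → j ≠ i → bary x j = 0 := by
  constructor
  · rintro ⟨s, t, hs, ht, hst, rfl⟩
    refine ⟨fun j => ?_, fun j h0 hj => ?_⟩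
    · rw [bary_add_smul _ _ _ _ hst, bary_vertex, bary_vertex]
      split_ifs <;> simp <;> positivity
    · rw [bary_add_smul _ _ _ _ hst, bary_vertex, bary_vertex, if_neg h0.symm, if_neg hj.symm]
      simp
  · rintro ⟨h1, h2⟩
    have e1 := sum_bary x
    have e2 := sum_bary_smul x
    rw [Fin.sum_univ_four] at e1 e2
    refine ⟨bary x 0, bary x i, h1 0, h1 i, ?_, ?_⟩
    · rw [← e1]
      fin_cases i <;> simp at h2 hi ⊢ <;> simp [h2]
    · conv_rhs => rw [← e2]
      fin_cases i <;> simp at h2 hi ⊢ <;> simp [h2]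

theorem isGeometricTree_cut : IsGeometricTree cut := by
  have hinj : Function.Injective vertex := by
    intro i j h
    have := congrArg (fun x => bary x j) h
    simp only [bary_vertex, if_true] at this
    by_contra hne
    simp [hne] at this
  refine ⟨4, SimpleGraph.starGraph 0, vertex, SimpleGraph.isTree_starGraph 0, hinj, ?_, ?_⟩
  · have key : ∀ j l : Fin 4, j ≠ 0 → l ≠ 0 → j ≠ l →
        segment ℝ (vertex 0) (vertex j) ∩ segment ℝ (vertex 0) (vertex l) ⊆ {vertex 0} := by
      rintro j l hj hl hjl x ⟨h1, h2⟩
      rw [mem_segment_vertex hj] at h1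
      rw [mem_segment_vertex hl] at h2
      have h3 : ∀ i, i ≠ 0 → bary x i = 0 := by
        intro i hi
        by_cases h : i = j
        · exact h2.2 i hi (h ▸ hjl)
        · exact h1.2 i hi h
      have e1 := sum_bary x
      have e2 := sum_bary_smul x
      rw [Fin.sum_univ_four] at e1 e2
      rw [h3 1 (by decide), h3 2 (by decide), h3 3 (by decide)] at e1 e2
      simp only [add_zero] at e1
      rw [e1] at e2
      simpa using e2.symm
    have key' : ∀ i j k l : Fin 4, (i = 0 ∧ j ≠ 0) → (k = 0 ∧ l ≠ 0) → s(i, j) ≠ s(k, l) →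
        segment ℝ (vertex i) (vertex j) ∩ segment ℝ (vertex k) (vertex l) ⊆
          {vertex i, vertex j} ∩ {vertex k, vertex l} := by
      rintro i j k l ⟨rfl, hj⟩ ⟨rfl, hl⟩ hne x hx
      have hx0 := key j l hj hl (fun h => hne (by rw [h])) hx
      rw [Set.mem_singleton_iff] at hx0
      simp [hx0]
    have hadj : ∀ i j : Fin 4, (SimpleGraph.starGraph 0).Adj i j →
        (i = 0 ∧ j ≠ 0) ∨ (j = 0 ∧ i ≠ 0) := by
      intro i j h
      rw [SimpleGraph.starGraph_adj] at h
      rcases h with ⟨hne, rfl | rfl⟩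
      · exact Or.inl ⟨rfl, hne.symm⟩
      · exact Or.inr ⟨rfl, hne⟩
    intro i j k l hij hkl hne
    rcases hadj i j hij with h1 | h1 <;> rcases hadj k l hkl with h2 | h2
    · exact key' i j k l h1 h2 hne
    · rw [segment_symm ℝ (vertex k), Set.pair_comm (vertex k)]
      exact key' i j l k h1 h2 (by rwa [Sym2.eq_swap (a := l)])
    · rw [segment_symm ℝ (vertex i), Set.pair_comm (vertex i)]
      exact key' j i k l h1 h2 (by rwa [Sym2.eq_swap (a := j)])
    · rw [segment_symm ℝ (vertex i), Set.pair_comm (vertex i), segment_symm ℝ (vertex k),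
        Set.pair_comm (vertex k)]
      exact key' j i l k h1 h2 (by rwa [Sym2.eq_swap (a := j), Sym2.eq_swap (a := l)])
  · apply Set.Subset.antisymm
    · rintro x ⟨i, hi, hx⟩
      refine Or.inr ?_
      simp only [Set.mem_iUnion]
      exact ⟨0, i, SimpleGraph.starGraph_adj.2 ⟨hi.symm, Or.inl rfl⟩, hx⟩
    · rintro x (⟨i, rfl⟩ | hx)
      · by_cases hi : i = 0
        · subst hi
          exact ⟨1, by decide, left_mem_segment _ _ _⟩
        · exact ⟨i, hi, right_mem_segment _ _ _⟩
      · simp only [Set.mem_iUnion] at hx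
        obtain ⟨i, j, hij, hx⟩ := hx
        rw [SimpleGraph.starGraph_adj] at hij
        rcases hij with ⟨hne, rfl | rfl⟩
        · exact ⟨j, hne.symm, hx⟩
        · exact ⟨i, hne, by rwa [segment_symm]⟩

theorem cut_subset : cut ⊆ frontier solid := by
  rintro x ⟨i, hi, hx⟩
  rw [mem_segment_vertex hi] at hx
  refine mem_frontier_solid.2 ⟨hx.1, ?_⟩
  by_cases h : i = 1
  · exact ⟨2, hx.2 2 (by decide) (by rw [h]; decide)⟩
  · exact ⟨1, hx.2 1 (by decide) (Ne.symm h)⟩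

/-- For nonnegative numbers, the sum of pairwise products vanishes exactly when at most one is
nonzero. This sum is the denominator in `unfold`, which is therefore continuous off the cut. -/
theorem mem_cut {x : Space3} : x ∈ cut ↔ (∀ i, 0 ≤ bary x i) ∧
    bary x 1 * bary x 2 + bary x 2 * bary x 3 + bary x 3 * bary x 1 = 0 := by
  constructor
  · rintro ⟨i, hi, hx⟩
    rw [mem_segment_vertex hi] at hx
    refine ⟨hx.1, ?_⟩
    have := hx.2
    fin_cases i <;> simp at this hi <;> simp [this]
  · rintro ⟨h, h0⟩
    have h12 := mul_nonneg (h 1) (h 2)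
    have h23 := mul_nonneg (h 2) (h 3)
    have h31 := mul_nonneg (h 3) (h 1)
    have e1 : bary x 1 * bary x 2 = 0 := by linarith
    have e2 : bary x 2 * bary x 3 = 0 := by linarith
    have e3 : bary x 3 * bary x 1 = 0 := by linarith
    have key : ∃ i : Fin 4, i ≠ 0 ∧ ∀ j, j ≠ 0 → j ≠ i → bary x j = 0 := by
      rcases mul_eq_zero.1 e1 with h1 | h2
      · rcases mul_eq_zero.1 e2 with h2 | h3
        · exact ⟨3, by decide, fun j h0 hj => by fin_cases j <;> simp_all⟩
        · exact ⟨2, by decide, fun j h0 hj => by fin_cases j <;> simp_all⟩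
      · rcases mul_eq_zero.1 e3 with h3 | h1
        · exact ⟨1, by decide, fun j h0 hj => by fin_cases j <;> simp_all⟩
        · exact ⟨3, by decide, fun j h0 hj => by fin_cases j <;> simp_all⟩
    obtain ⟨i, hi, h1⟩ := key
    exact ⟨i, hi, (mem_segment_vertex hi).2 ⟨h, h1⟩⟩

end Tetrahedron

/-! ### The unfolding of the regular tetrahedron onto a triangle. -/

namespace Tetrahedron

/-- A coordinate of the unfolding of a point of the surface of the tetrahedron, as a function of the
barycentric coordinates of this point: the development of the three faces at the vertex `0` into the
plane of the opposite face. -/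
noncomputable def unfold (d a b c : ℝ) : ℝ := a + d - 2 * (d * (b * c) / (a * b + b * c + c * a))

/-- One rational expression restricts to an affine map on each face minus the cut. This and the next
three lemmas give these restrictions, so continuity across the base edges needs no gluing. -/
theorem unfold_base (a b c : ℝ) : unfold 0 a b c = a := by simp [unfold]

theorem unfold_own {d b c : ℝ} (h : 0 < b * c) : unfold d 0 b c = -d := by
  simp only [unfold, zero_mul, mul_zero, zero_add, add_zero]
  rw [mul_div_cancel_right₀ _ h.ne']; ring

theorem unfold_left (d a c : ℝ) : unfold d a 0 c = a + d := by simp [unfold]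

theorem unfold_right (d a b : ℝ) : unfold d a b 0 = a + d := by simp [unfold]

/-- The barycentric coordinates of the point of the plane of the base in which the tetrahedron is
unfolded. -/
noncomputable def planeBary (q : Plane2) : Fin 3 → ℝ :=
  ![(1 - q 1 / √6 + q 0 / √2) / 2, (1 - q 1 / √6 - q 0 / √2) / 2, q 1 / √6]

/-- The point of the plane with given barycentric coordinates. -/
noncomputable def planePoint (a b c : ℝ) : Plane2 := !₂[√2 * (a - b), √6 * c]

theorem planeBary_planePoint {a b c : ℝ} (h : a + b + c = 1) :
    planeBary (planePoint a b c) = ![a, b, c] := by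
  have h2 : √2 ≠ 0 := by positivity
  have h6 : √6 ≠ 0 := by positivity
  simp only [planeBary, planePoint]
  ext i
  fin_cases i <;> simp [mul_div_cancel_left₀ _ h2, mul_div_cancel_left₀ _ h6] <;> linarith

theorem planePoint_planeBary (q : Plane2) :
    planePoint (planeBary q 0) (planeBary q 1) (planeBary q 2) = q := by
  ext i
  fin_cases i <;> simp [planeBary, planePoint] <;> field_simp <;> ring

theorem sum_planeBary (q : Plane2) : planeBary q 0 + planeBary q 1 + planeBary q 2 = 1 := by
  simp [planeBary]; ring

theorem continuous_planeBary (i : Fin 3) : Continuous fun q => planeBary q i := by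
  fin_cases i <;> simp only [planeBary] <;> simp <;> fun_prop

/-- The triangle onto which the tetrahedron is unfolded. -/
noncomputable def triangle : Set Plane2 :=
  convexHull ℝ {planePoint (-1) 1 1, planePoint 1 (-1) 1, planePoint 1 1 (-1)}

/-- The base is the medial triangle of the large one: a base coordinate `t` corresponds to the large
barycentric coordinate `(1 - t) / 2`. -/
theorem mem_triangle {q : Plane2} : q ∈ triangle ↔ ∀ i, planeBary q i ≤ 1 := by
  constructor
  · intro hq i
    refine convexHull_min (t := {q | planeBary q i ≤ 1}) ?_ ?_ hq
    · rintro _ (rfl | rfl | rfl) <;> rw [Set.mem_ofPred_eq, planeBary_planePoint (by norm_num)] <;>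
      fin_cases i <;> simp
    · intro y hy z hz s t hs ht hst
      rw [Set.mem_ofPred_eq] at *
      have : planeBary (s • y + t • z) i = s * planeBary y i + t * planeBary z i := by
        obtain rfl : t = 1 - s := by linarith
        fin_cases i <;> simp [planeBary] <;> ring
      rw [this]
      nlinarith
  · intro h
    have hs := sum_planeBary q
    have := (convex_convexHull ℝ _ : Convex ℝ triangle).sum_mem (t := Finset.univ)
      (w := fun i => (1 - planeBary q i) / 2)
      (z := ![planePoint (-1) 1 1, planePoint 1 (-1) 1, planePoint 1 1 (-1)])
      (fun i _ => by have := h i; linarith)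
      (by rw [Fin.sum_univ_three]; linarith)
      (by intro i _; fin_cases i <;> exact subset_convexHull ℝ _ (by simp))
    suffices hq : q = ∑ i, ((1 - planeBary q i) / 2) •
        ![planePoint (-1) 1 1, planePoint 1 (-1) 1, planePoint 1 1 (-1)] i by
      rw [hq]; exact this
    conv_lhs => rw [← planePoint_planeBary q]
    have e : planeBary q 2 = 1 - planeBary q 0 - planeBary q 1 := by linarith
    ext i
    fin_cases i <;> simp [Fin.sum_univ_three, planePoint, e] <;> ring

theorem mem_interior_triangle {q : Plane2} : q ∈ interior triangle ↔ ∀ i, planeBary q i < 1 := by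
  constructor
  · intro hq i
    have key (w : Plane2) (hw : ∀ t : ℝ, planeBary (q + t • w) i = planeBary q i + t) :=
      lt_of_mem_interior hq (f := fun q => planeBary q i) hw (c := 1)
        fun y hy => mem_triangle.1 hy i
    have h2 : √2 ≠ 0 := by positivity
    have h6 : √6 ≠ 0 := by positivity
    fin_cases i
    · exact key !₂[2 * √2, 0] fun t => by simp [planeBary]; field_simp; ring
    · exact key !₂[-(2 * √2), 0] fun t => by simp [planeBary]; field_simp; ring
    · exact key !₂[0, √6] fun t => by simp [planeBary]; field_simp
  · intro h
    have : IsOpen (⋂ i, {q | planeBary q i < 1}) :=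
      isOpen_iInter_of_finite fun i => isOpen_lt (continuous_planeBary i) continuous_const
    refine interior_maximal (fun y hy => mem_triangle.2 fun i => ?_) this (by simpa using h)
    exact (Set.mem_iInter.1 hy i).le

theorem isConvexPolygon_triangle : IsConvexPolygon triangle := by
  refine ⟨⟨_, by simp, rfl⟩, planePoint (1 / 3) (1 / 3) (1 / 3), ?_⟩
  rw [mem_interior_triangle, planeBary_planePoint (by norm_num)]
  intro i
  fin_cases i <;> simp <;> norm_num

/-- The unfolding of the tetrahedron. -/
noncomputable def flatten (x : Space3) : Plane2 :=
  planePoint (unfold (bary x 0) (bary x 1) (bary x 2) (bary x 3))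
    (unfold (bary x 0) (bary x 2) (bary x 3) (bary x 1))
    (unfold (bary x 0) (bary x 3) (bary x 1) (bary x 2))

/-- The inverse of the unfolding of the tetrahedron. -/
noncomputable def fold (q : Plane2) : Space3 :=
  -- Off the base exactly one plane coordinate is negative and equals `-d`. As the coordinates sum
  -- to one, their absolute values sum to `1 + 2 * d`, and each is a barycentric coordinate of the
  -- solid plus `d`.
  let d := (|planeBary q 0| + |planeBary q 1| + |planeBary q 2| - 1) / 2
  d • vertex 0 + (|planeBary q 0| - d) • vertex 1 + (|planeBary q 1| - d) • vertex 2 +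
    (|planeBary q 2| - d) • vertex 3

theorem bary_fold (q : Plane2) :
    bary (fold q) 0 = (|planeBary q 0| + |planeBary q 1| + |planeBary q 2| - 1) / 2 ∧
    bary (fold q) 1 = |planeBary q 0| - bary (fold q) 0 ∧
    bary (fold q) 2 = |planeBary q 1| - bary (fold q) 0 ∧
    bary (fold q) 3 = |planeBary q 2| - bary (fold q) 0 := by
  refine ⟨?_, ?_, ?_, ?_⟩ <;> simp [bary, fold, vertex] <;> ring

/-- The cut surface consists of four pieces, on each of which the unfolding has a simple form. -/
theorem cut_surface_cases {x : Space3} (hx : x ∈ frontier solid \ cut) :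
    (bary x 0 = 0 ∧ bary x 1 < 1 ∧ bary x 2 < 1 ∧ bary x 3 < 1) ∨
    (bary x 1 = 0 ∧ 0 < bary x 2 ∧ 0 < bary x 3) ∨
    (bary x 2 = 0 ∧ 0 < bary x 3 ∧ 0 < bary x 1) ∨
    (bary x 3 = 0 ∧ 0 < bary x 1 ∧ 0 < bary x 2) := by
  obtain ⟨h1, h2⟩ := hx
  rw [mem_frontier_solid] at h1
  obtain ⟨h, i, hi⟩ := h1
  rw [mem_cut, not_and] at h2
  have hD := h2 h
  have hs := sum_bary x
  rw [Fin.sum_univ_four] at hs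
  have p0 := h 0
  have p1 := h 1
  have p2 := h 2
  have p3 := h 3
  fin_cases i
  · have hi : bary x 0 = 0 := hi
    refine Or.inl ⟨hi, ?_, ?_, ?_⟩ <;> by_contra! hlt
    · have e2 : bary x 2 = 0 := by linarith
      have e3 : bary x 3 = 0 := by linarith
      exact hD (by rw [e2, e3]; ring)
    · have e2 : bary x 1 = 0 := by linarith
      have e3 : bary x 3 = 0 := by linarith
      exact hD (by rw [e2, e3]; ring)
    · have e2 : bary x 1 = 0 := by linarith
      have e3 : bary x 2 = 0 := by linarith
      exact hD (by rw [e2, e3]; ring)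
  · have hi : bary x 1 = 0 := hi
    rw [hi] at hD
    refine Or.inr (Or.inl ⟨hi, lt_of_le_of_ne p2 fun h => hD (by rw [← h]; ring),
      lt_of_le_of_ne p3 fun h => hD (by rw [← h]; ring)⟩)
  · have hi : bary x 2 = 0 := hi
    rw [hi] at hD
    refine Or.inr (Or.inr (Or.inl ⟨hi, lt_of_le_of_ne p3 fun h => hD (by rw [← h]; ring),
      lt_of_le_of_ne p1 fun h => hD (by rw [← h]; ring)⟩))
  · have hi : bary x 3 = 0 := hi
    rw [hi] at hD
    refine Or.inr (Or.inr (Or.inr ⟨hi, lt_of_le_of_ne p1 fun h => hD (by rw [← h]; ring),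
      lt_of_le_of_ne p2 fun h => hD (by rw [← h]; ring)⟩))

theorem flatten_base {x : Space3} (h : bary x 0 = 0) :
    flatten x = planePoint (bary x 1) (bary x 2) (bary x 3) := by
  rw [flatten, h, unfold_base, unfold_base, unfold_base]

theorem flatten_one {x : Space3} (h : bary x 1 = 0) (h2 : 0 < bary x 2) (h3 : 0 < bary x 3) :
    flatten x = planePoint (-bary x 0) (bary x 2 + bary x 0) (bary x 3 + bary x 0) := by
  rw [flatten, h, unfold_own (by positivity), unfold_right, unfold_left]

theorem flatten_two {x : Space3} (h : bary x 2 = 0) (h3 : 0 < bary x 3) (h1 : 0 < bary x 1) :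
    flatten x = planePoint (bary x 1 + bary x 0) (-bary x 0) (bary x 3 + bary x 0) := by
  rw [flatten, h, unfold_own (by positivity), unfold_right, unfold_left]

theorem flatten_three {x : Space3} (h : bary x 3 = 0) (h1 : 0 < bary x 1) (h2 : 0 < bary x 2) :
    flatten x = planePoint (bary x 1 + bary x 0) (bary x 2 + bary x 0) (-bary x 0) := by
  rw [flatten, h, unfold_own (by positivity), unfold_right, unfold_left]

theorem bary_injective {x y : Space3} (h : ∀ i, bary x i = bary y i) : x = y := by
  rw [← sum_bary_smul x, ← sum_bary_smul y]
  simp only [h]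

theorem sum_bary' (x : Space3) : bary x 0 + bary x 1 + bary x 2 + bary x 3 = 1 := by
  rw [← sum_bary x, Fin.sum_univ_four]

theorem flatten_mem {x : Space3} (hx : x ∈ frontier solid \ cut) :
    flatten x ∈ interior triangle := by
  have hs := sum_bary' x
  have p0 := (mem_frontier_solid.1 hx.1).1 0
  rw [mem_interior_triangle]
  rcases cut_surface_cases hx with ⟨h, h1, h2, h3⟩ | ⟨h, h1, h2⟩ | ⟨h, h1, h2⟩ | ⟨h, h1, h2⟩
  · rw [flatten_base h, planeBary_planePoint (by linarith)]
    intro i; fin_cases i <;> simpa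
  · rw [flatten_one h h1 h2, planeBary_planePoint (by linarith)]
    intro i; fin_cases i <;> simp <;> linarith
  · rw [flatten_two h h1 h2, planeBary_planePoint (by linarith)]
    intro i; fin_cases i <;> simp <;> linarith
  · rw [flatten_three h h1 h2, planeBary_planePoint (by linarith)]
    intro i; fin_cases i <;> simp <;> linarith

theorem fold_flatten {x : Space3} (hx : x ∈ frontier solid \ cut) : fold (flatten x) = x := by
  have hs := sum_bary' x
  have p0 := (mem_frontier_solid.1 hx.1).1 0
  have p1 := (mem_frontier_solid.1 hx.1).1 1
  have p2 := (mem_frontier_solid.1 hx.1).1 2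
  have p3 := (mem_frontier_solid.1 hx.1).1 3
  have key : ∀ a b c : ℝ, planeBary (flatten x) = ![a, b, c] → |a| = bary x 1 + bary x 0 →
      |b| = bary x 2 + bary x 0 → |c| = bary x 3 + bary x 0 → fold (flatten x) = x := by
    intro a b c h ha hb hc
    obtain ⟨h0, h1, h2, h3⟩ := bary_fold (flatten x)
    simp only [h, Matrix.cons_val_zero, Matrix.cons_val_one, Matrix.cons_val, ha, hb, hc] at h0 h1 h2 h3
    refine bary_injective fun i => ?_
    fin_cases i
    · change bary _ 0 = bary _ 0; linarith
    · change bary _ 1 = bary _ 1; linarith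
    · change bary _ 2 = bary _ 2; linarith
    · change bary _ 3 = bary _ 3; linarith
  rcases cut_surface_cases hx with ⟨h, h1, h2, h3⟩ | ⟨h, h1, h2⟩ | ⟨h, h1, h2⟩ | ⟨h, h1, h2⟩
  · refine key _ _ _ (by rw [flatten_base h, planeBary_planePoint (by linarith)]) ?_ ?_ ?_ <;>
    rw [abs_of_nonneg (by linarith)] <;> linarith
  · refine key _ _ _ (by rw [flatten_one h h1 h2, planeBary_planePoint (by linarith)]) ?_ ?_ ?_
    · rw [abs_neg, abs_of_nonneg p0]; linarith
    · rw [abs_of_nonneg (by linarith)]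
    · rw [abs_of_nonneg (by linarith)]
  · refine key _ _ _ (by rw [flatten_two h h1 h2, planeBary_planePoint (by linarith)]) ?_ ?_ ?_
    · rw [abs_of_nonneg (by linarith)]
    · rw [abs_neg, abs_of_nonneg p0]; linarith
    · rw [abs_of_nonneg (by linarith)]
  · refine key _ _ _ (by rw [flatten_three h h1 h2, planeBary_planePoint (by linarith)]) ?_ ?_ ?_
    · rw [abs_of_nonneg (by linarith)]
    · rw [abs_of_nonneg (by linarith)]
    · rw [abs_neg, abs_of_nonneg p0]; linarith

theorem fold_mem_and_flatten_fold {q : Plane2} (hq : q ∈ interior triangle) :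
    fold q ∈ frontier solid \ cut ∧ flatten (fold q) = q := by
  rw [mem_interior_triangle] at hq
  have hs := sum_planeBary q
  have q0 := hq 0
  have q1 := hq 1
  have q2 := hq 2
  obtain ⟨h0, h1, h2, h3⟩ := bary_fold q
  set a := planeBary q 0 with ha
  set b := planeBary q 1 with hb
  set c := planeBary q 2 with hc
  have hpt : planePoint a b c = q := planePoint_planeBary q
  set x := fold q
  have mem (hp : ∀ i, 0 ≤ bary x i) (h0 : ∃ i, bary x i = 0)
      (hD : bary x 1 * bary x 2 + bary x 2 * bary x 3 + bary x 3 * bary x 1 ≠ 0) :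
      x ∈ frontier solid \ cut :=
    ⟨mem_frontier_solid.2 ⟨hp, h0⟩, fun h => hD (mem_cut.1 h).2⟩
  have nonneg {x : Space3} (p0 : 0 ≤ bary x 0) (p1 : 0 ≤ bary x 1) (p2 : 0 ≤ bary x 2)
      (p3 : 0 ≤ bary x 3) : ∀ i, 0 ≤ bary x i := by
    intro i; fin_cases i <;> assumption
  -- The coordinates sum to one and are less than one, so at most one is negative; it names the face
  -- of the flap.
  rcases lt_or_ge a 0 with na | pa
  · rw [abs_of_neg na, abs_of_pos (by linarith : 0 < b), abs_of_pos (by linarith : 0 < c)] at h0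
    rw [abs_of_neg na] at h1
    rw [abs_of_pos (by linarith : 0 < b)] at h2
    rw [abs_of_pos (by linarith : 0 < c)] at h3
    have e1 : bary x 1 = 0 := by linarith
    have e2 : 0 < bary x 2 := by linarith
    have e3 : 0 < bary x 3 := by linarith
    refine ⟨mem (nonneg (by linarith) e1.ge e2.le e3.le) ⟨1, e1⟩ (by rw [e1]; positivity), ?_⟩
    rw [flatten_one e1 e2 e3, ← hpt]
    congr 1 <;> linarith
  rcases lt_or_ge b 0 with nb | pb
  · rw [abs_of_pos (by linarith : 0 < a), abs_of_neg nb, abs_of_pos (by linarith : 0 < c)] at h0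
    rw [abs_of_pos (by linarith : 0 < a)] at h1
    rw [abs_of_neg nb] at h2
    rw [abs_of_pos (by linarith : 0 < c)] at h3
    have e1 : 0 < bary x 1 := by linarith
    have e2 : bary x 2 = 0 := by linarith
    have e3 : 0 < bary x 3 := by linarith
    refine ⟨mem (nonneg (by linarith) e1.le e2.ge e3.le) ⟨2, e2⟩ (by rw [e2]; positivity), ?_⟩
    rw [flatten_two e2 e3 e1, ← hpt]
    congr 1 <;> linarith
  rcases lt_or_ge c 0 with nc | pc
  · rw [abs_of_pos (by linarith : 0 < a), abs_of_pos (by linarith : 0 < b), abs_of_neg nc] at h0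
    rw [abs_of_pos (by linarith : 0 < a)] at h1
    rw [abs_of_pos (by linarith : 0 < b)] at h2
    rw [abs_of_neg nc] at h3
    have e1 : 0 < bary x 1 := by linarith
    have e2 : 0 < bary x 2 := by linarith
    have e3 : bary x 3 = 0 := by linarith
    refine ⟨mem (nonneg (by linarith) e1.le e2.le e3.ge) ⟨3, e3⟩ (by rw [e3]; positivity), ?_⟩
    rw [flatten_three e3 e1 e2, ← hpt]
    congr 1 <;> linarith
  · rw [abs_of_nonneg pa, abs_of_nonneg pb, abs_of_nonneg pc] at h0
    rw [abs_of_nonneg pa] at h1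
    rw [abs_of_nonneg pb] at h2
    rw [abs_of_nonneg pc] at h3
    have e0 : bary x 0 = 0 := by linarith
    have e1 : bary x 1 = a := by linarith
    have e2 : bary x 2 = b := by linarith
    have e3 : bary x 3 = c := by linarith
    refine ⟨mem (nonneg e0.ge (by linarith) (by linarith) (by linarith)) ⟨0, e0⟩ ?_, ?_⟩
    · rw [e1, e2, e3]
      intro hD
      have hab := mul_nonneg pa pb
      have hbc := mul_nonneg pb pc
      have hca := mul_nonneg pc pa
      have : a * (b + c) = 0 := by linarith
      rcases mul_eq_zero.1 this with h | h
      · have : b * c = 0 := by linarith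
        rcases mul_eq_zero.1 this with h | h <;> linarith
      · linarith
    · rw [flatten_base e0, e1, e2, e3, hpt]

theorem continuousOn_flatten : ContinuousOn flatten (frontier solid \ cut) := by
  have hD : ∀ x ∈ frontier solid \ cut,
      bary x 1 * bary x 2 + bary x 2 * bary x 3 + bary x 3 * bary x 1 ≠ 0 :=
    fun x hx h => hx.2 (mem_cut.2 ⟨(mem_frontier_solid.1 hx.1).1, h⟩)
  have hb (i : Fin 4) : ContinuousOn (fun x => bary x i) (frontier solid \ cut) :=
    (continuous_bary i).continuousOn
  have hu : ∀ i j k : Fin 4,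
      (∀ x ∈ frontier solid \ cut, bary x i * bary x j + bary x j * bary x k +
        bary x k * bary x i ≠ 0) →
      ContinuousOn (fun x => unfold (bary x 0) (bary x i) (bary x j) (bary x k))
        (frontier solid \ cut) := by
    intro i j k h
    unfold unfold
    refine ContinuousOn.sub ((hb i).add (hb 0)) (continuousOn_const.mul (ContinuousOn.div ?_ ?_ h))
    · exact (hb 0).mul ((hb j).mul (hb k))
    · exact (((hb i).mul (hb j)).add ((hb j).mul (hb k))).add ((hb k).mul (hb i))
  have h1 := hu 1 2 3 hD
  have h2 := hu 2 3 1 fun x hx h => hD x hx (by linarith)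
  have h3 := hu 3 1 2 fun x hx h => hD x hx (by linarith)
  refine (PiLp.continuous_toLp 2 _).comp_continuousOn (continuousOn_pi.2 fun i => ?_)
  fin_cases i
  · exact continuousOn_const.mul (h1.sub h2)
  · exact continuousOn_const.mul h3

theorem continuous_fold : Continuous fold := by
  have h0 := continuous_planeBary 0
  have h1 := continuous_planeBary 1
  have h2 := continuous_planeBary 2
  unfold fold
  fun_prop

/-- The scales `√2` and `√6` make the base an equilateral triangle of side `2 * √2`, the edge length
of the solid. -/
theorem dist_planePoint (a b c a' b' c' : ℝ) :
    dist (planePoint a b c) (planePoint a' b' c') =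
      √(2 * ((a - b) - (a' - b')) ^ 2 + 6 * (c - c') ^ 2) := by
  rw [EuclideanSpace.dist_eq, Fin.sum_univ_two]
  congr 1
  simp only [Real.dist_eq, sq_abs]
  simp only [planePoint]
  simp only [Matrix.cons_val_zero, Matrix.cons_val_one]
  rw [← mul_sub, ← mul_sub, mul_pow, mul_pow, Real.sq_sqrt (by norm_num), Real.sq_sqrt (by norm_num)]

/-- On a common face the unfolding is affine. Eliminating one space coordinate by the equation of
the face turns the equality of squared distances into a polynomial identity. -/
theorem dist_flatten {y z : Space3} (hy : y ∈ frontier solid \ cut) (hz : z ∈ frontier solid \ cut)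
    (h : ∃ i, bary y i = 0 ∧ bary z i = 0) : dist (flatten y) (flatten z) = dist y z := by
  have hcase (x : Space3) (hx : x ∈ frontier solid \ cut) :
      (bary x 1 = 0 → 0 < bary x 2 ∧ 0 < bary x 3) ∧ (bary x 2 = 0 → 0 < bary x 3 ∧ 0 < bary x 1) ∧
      (bary x 3 = 0 → 0 < bary x 1 ∧ 0 < bary x 2) := by
    have hs := sum_bary' x
    have p1 := (mem_frontier_solid.1 hx.1).1 1
    have p2 := (mem_frontier_solid.1 hx.1).1 2
    have p3 := (mem_frontier_solid.1 hx.1).1 3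
    have hD : bary x 1 * bary x 2 + bary x 2 * bary x 3 + bary x 3 * bary x 1 ≠ 0 :=
      fun h => hx.2 (mem_cut.2 ⟨(mem_frontier_solid.1 hx.1).1, h⟩)
    refine ⟨fun h => ?_, fun h => ?_, fun h => ?_⟩ <;> rw [h] at hD <;> constructor <;>
    refine lt_of_le_of_ne (by assumption) fun h0 => hD ?_ <;> rw [← h0] <;> ring
  obtain ⟨i, hyi, hzi⟩ := h
  rw [EuclideanSpace.dist_eq y z, Fin.sum_univ_three]
  simp only [Real.dist_eq, sq_abs]
  have hb (x : Space3) : bary x 0 = (1 + x 0 + x 1 + x 2) / 4 ∧ bary x 1 = (1 + x 0 - x 1 - x 2) / 4 ∧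
      bary x 2 = (1 - x 0 + x 1 - x 2) / 4 ∧ bary x 3 = (1 - x 0 - x 1 + x 2) / 4 :=
    ⟨rfl, rfl, rfl, rfl⟩
  obtain ⟨y0, y1, y2, y3⟩ := hb y
  obtain ⟨z0, z1, z2, z3⟩ := hb z
  fin_cases i
  · have hyi : bary y 0 = 0 := hyi
    have hzi : bary z 0 = 0 := hzi
    rw [flatten_base hyi, flatten_base hzi, dist_planePoint, y1, y2, y3, z1, z2, z3]
    congr 1
    have ey : y 2 = -1 - y 0 - y 1 := by linarith
    have ez : z 2 = -1 - z 0 - z 1 := by linarith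
    rw [ey, ez]; ring
  · have hyi : bary y 1 = 0 := hyi
    have hzi : bary z 1 = 0 := hzi
    rw [flatten_one hyi ((hcase y hy).1 hyi).1 ((hcase y hy).1 hyi).2,
      flatten_one hzi ((hcase z hz).1 hzi).1 ((hcase z hz).1 hzi).2, dist_planePoint, y0, y2, y3,
      z0, z2, z3]
    congr 1
    have ey : y 2 = 1 + y 0 - y 1 := by linarith
    have ez : z 2 = 1 + z 0 - z 1 := by linarith
    rw [ey, ez]; ring
  · have hyi : bary y 2 = 0 := hyi
    have hzi : bary z 2 = 0 := hzi
    rw [flatten_two hyi ((hcase y hy).2.1 hyi).1 ((hcase y hy).2.1 hyi).2,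
      flatten_two hzi ((hcase z hz).2.1 hzi).1 ((hcase z hz).2.1 hzi).2, dist_planePoint, y0, y1, y3,
      z0, z1, z3]
    congr 1
    have ey : y 2 = 1 - y 0 + y 1 := by linarith
    have ez : z 2 = 1 - z 0 + z 1 := by linarith
    rw [ey, ez]; ring
  · have hyi : bary y 3 = 0 := hyi
    have hzi : bary z 3 = 0 := hzi
    rw [flatten_three hyi ((hcase y hy).2.2 hyi).1 ((hcase y hy).2.2 hyi).2,
      flatten_three hzi ((hcase z hz).2.2 hzi).1 ((hcase z hz).2.2 hzi).2, dist_planePoint, y0, y1, y2,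
      z0, z1, z2]
    congr 1
    have ey : y 2 = y 0 + y 1 - 1 := by linarith
    have ez : z 2 = z 0 + z 1 - 1 := by linarith
    rw [ey, ez]; ring

theorem flattensOnto_triangle : FlattensOnto solid cut triangle := by
  refine ⟨⟨⟨fun x => ⟨flatten x, flatten_mem x.2⟩,
    fun q => ⟨fold q, (fold_mem_and_flatten_fold q.2).1⟩, fun x => Subtype.ext (fold_flatten x.2),
    fun q => Subtype.ext (fold_mem_and_flatten_fold q.2).2⟩, ?_, ?_⟩, ?_⟩
  · exact (continuousOn_iff_continuous_domRestrict.1 continuousOn_flatten).subtype_mk _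
  · exact (continuous_fold.comp continuous_subtype_val).subtype_mk _
  · intro y z hyz
    refine dist_flatten y.2 z.2 ?_
    -- Some coordinate vanishes at the midpoint; being nonnegative at both ends, it vanishes there
    -- too, so the ends share a face.
    have hm : (1 / 2 : ℝ) • (y : Space3) + (1 / 2 : ℝ) • (z : Space3) ∈ frontier solid :=
      (hyz ⟨1 / 2, 1 / 2, by norm_num, by norm_num, by norm_num, rfl⟩).1
    obtain ⟨-, i, hi⟩ := mem_frontier_solid.1 hm
    rw [bary_add_smul _ _ _ _ (by norm_num)] at hi
    have hy := (mem_frontier_solid.1 y.2.1).1 i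
    have hz := (mem_frontier_solid.1 z.2.1).1 i
    exact ⟨i, by linarith, by linarith⟩

theorem hasConvexUnfolding : HasConvexUnfolding solid :=
  ⟨triangle, isConvexPolygon_triangle, cut, isGeometricTree_cut, cut_subset, flattensOnto_triangle⟩

end Tetrahedron

theorem mainTheorem2 (s : PlatonicSolid) (Q : Set Space3) (hQ : IsPlatonic s Q) :
    HasConvexUnfolding Q ↔ s = PlatonicSolid.tetrahedron := by
  rw [hQ.hasConvexUnfolding_iff]
  refine ⟨fun h => ?_, ?_⟩
  · by_contra hs
    exact not_hasConvexUnfolding_convexHull hs h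
  · rintro rfl
    exact Tetrahedron.hasConvexUnfolding
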